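/- Let $d\ge 1$, $\Omega=(0,1)^d$, $0<p\le\infty$, $s>d/p$ (with $d/p:=0$ if $p=\infty$), and let $r$ be any integer with $r>s$. For $\mathbf h\in\mathbb R^d$ put $$\Delta^r_{\mathbf h}(f,\mathbf x):=(-1)^r\sum_{k=0}^r(-1)^k\binom rk f(\mathbf x+k\mathbf h),\qquad A_{\mathbf h}:=\{\mathbf x\in A:[\mathbf x,\mathbf x+\mathbf h]\subset A\}\quad\text{for } A\subset\mathbb R^d,$$ where $[\mathbf x,\mathbf x+\mathbf h]$ is the line segment, and, with $|\mathbf h|$ the Euclidean norm, $$\omega_r(f,t)_p:=\sup_{|\mathbf h|\le t}\|\Delta^r_{\mathbf h}(f,\cdot)\|_{L_p(\Omega_{r\mathbf h})},\qquad \omega_r(g,t)_{C(\overline\Omega)}:=\sup_{|\mathbf h|\le t}\ \sup_{\mathbf x\in\overline\Omega_{r\mathbf h}}|\Delta^r_{\mathbf h}(g,\mathbf x)|.$$ Let $B^s_p(\Omega)=B^s_\infty(L_p(\Omega))$ be the set of all real-valued $f\in L_p(\Omega)$ with $$|f|_{B^s_p(\Omega)}:=\sup_{0<t\le1}t^{-s}\omega_r(f,t)_p<\infty.$$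 Then there is a constant $C$, depending only on $d,p,s,r$, such that for every $f\in B^s_p(\Omega)$ there is a continuous function $\tilde f$ on $\overline\Omega=[0,1]^d$ with $f=\tilde f$ a.e. on $\Omega$ and $$\omega_r(\tilde f,t)_{C(\overline\Omega)}\le C\,|f|_{B^s_p(\Omega)}\,t^{\,s-d/p},\qquad t>0.$$ In particular $\tilde f$ belongs to the (generalized) Lipschitz space $\mathrm{Lip}\,\alpha$ with $\alpha=s-d/p$, i.e. to the space of all continuous $g$ on $\overline\Omega$ for which there is a finite $M$ with $\omega_r(g,t)_{C(\overline\Omega)}\le Mt^{\alpha}$ for all $t>0$. -/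

import Mathlib

open MeasureTheory Set
open scoped ENNReal NNReal

noncomputable section

namespace BesovCube

/-- `ℝ^d` with the Euclidean norm. -/
abbrev E (d : ℕ) : Type := EuclideanSpace ℝ (Fin d)

/-- The open cube `Ω = (0,1)^d`. -/
def openCube (d : ℕ) : Set (E d) := {x | ∀ i, x i ∈ Ioo (0 : ℝ) 1}

/-- The closed cube `[0,1]^d`, the closure of `Ω`. -/
def closedCube (d : ℕ) : Set (E d) := {x | ∀ i, x i ∈ Icc (0 : ℝ) 1}

/-- `S_v = {x ∈ S : [x, x + v] ⊆ S}`, where `[x, x + v]` is the line segment. -/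
def shrink {d : ℕ} (S : Set (E d)) (v : E d) : Set (E d) :=
  {x | x ∈ S ∧ segment ℝ x (x + v) ⊆ S}

/-- The `r`-th difference `Δ_h^r f`, the `r`-fold iterate of `f ↦ f (· + h) - f`. -/
def diff {d : ℕ} (r : ℕ) (h : E d) (f : E d → ℝ) : E d → ℝ := (fwdDiff h)^[r] f

/-- `Δ_h^r f x = (-1)^r ∑_{k=0}^r (-1)^k (r choose k) f (x + k h)`. -/
theorem diff_eq_sum {d : ℕ} (r : ℕ) (h : E d) (f : E d → ℝ) (x : E d) :
    diff r h f x =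
      (-1) ^ r * ∑ k ∈ Finset.range (r + 1), (-1) ^ k * (r.choose k : ℝ) * f (x + k • h) := by
  rw [diff, fwdDiff_iter_eq_sum_shift, Finset.mul_sum]
  refine Finset.sum_congr rfl fun k hk => ?_
  have hk' : k ≤ r := Nat.lt_succ_iff.mp (Finset.mem_range.mp hk)
  have h1 : ((-1 : ℝ)) ^ (r - k) = (-1) ^ r * (-1) ^ k := by
    have h2 : (-1 : ℝ) ^ r = (-1) ^ (r - k) * (-1) ^ k := by
      rw [← pow_add, Nat.sub_add_cancel hk']
    rw [h2, mul_assoc, ← mul_pow]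
    simp
  simp [h1, mul_assoc]

/-- The modulus of smoothness
`ω_r(f,t)_p = sup_{|h| ≤ t} ‖Δ_h^r f‖_{L_p(Ω_{rh})}` on `Ω = (0,1)^d`, for `0 < p ≤ ∞`. -/
def modulus {d : ℕ} (r : ℕ) (p : ℝ≥0∞) (f : E d → ℝ) (t : ℝ) : ℝ≥0∞ :=
  ⨆ (h : E d) (_ : ‖h‖ ≤ t),
    eLpNorm (diff r h f) p (volume.restrict (shrink (openCube d) ((r : ℝ) • h)))

/-- The modulus of smoothness in the uniform norm, for functions on the closed cube:
`ω_r(g,t)_C = sup_{|h| ≤ t} sup {|Δ_h^r g(x)| : [x, x + r h] ⊆ [0,1]^d}`. -/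
def modulusC {d : ℕ} (r : ℕ) (g : E d → ℝ) (t : ℝ) : ℝ≥0∞ :=
  ⨆ (h : E d) (_ : ‖h‖ ≤ t) (x : E d) (_ : x ∈ shrink (closedCube d) ((r : ℝ) • h)),
    ‖diff r h g x‖ₑ

/-- The (quasi-)semi-norm `|f| = sup_{0 < t ≤ 1} t^{-s} ω_r(f,t)_p` of `B^s_∞(L_p((0,1)^d))`,
computed with differences of order `r`. -/
def besovSeminorm {d : ℕ} (r : ℕ) (s : ℝ) (p : ℝ≥0∞) (f : E d → ℝ) : ℝ≥0∞ :=
  ⨆ (t : ℝ) (_ : t ∈ Ioc (0 : ℝ) 1), ENNReal.ofReal (t ^ (-s)) * modulus r p f t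

/-- `f ∈ B^s_∞(L_p((0,1)^d))`, defined with differences of order `r` (to be used for `r > s`). -/
def MemBesov {d : ℕ} (r : ℕ) (s : ℝ) (p : ℝ≥0∞) (f : E d → ℝ) : Prop :=
  MemLp f p (volume.restrict (openCube d)) ∧ besovSeminorm r s p f < ∞

/-- The generalized Lipschitz space `Lip α` on the closed cube: continuous functions `g` with
`ω_r(g,t)_C ≤ M t^α` for all `t > 0`, for some finite `M`. -/
def MemLip {d : ℕ} (r : ℕ) (α : ℝ) (g : E d → ℝ) : Prop :=
  ContinuousOn g (closedCube d) ∧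
    ∃ M : ℝ≥0, ∀ t : ℝ, 0 < t → modulusC r g t ≤ M * ENNReal.ofReal (t ^ α)

end BesovCube

end

noncomputable section

namespace BesovCube

/-! The value F(y) differs from a fixed combination of the values F(y + jv), 1 ≤ j ≤ r, by an r-th
difference (`sub_shiftMean`), so pointwise values can be compared with averages. The L_p hypothesis,
however, controls Δ_v^r F only for a fixed step v and an integrated base point. A single random step
v = a(z - y) would tie the base points to the step. Hence `twoMean` uses two independent uniform
points of the cube. When the scale a doubles, the mean changes by r-th differences whose step
depends on one point and whose base is displaced by the other. Freezing the first point and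
integrating the second gives a p-th moment of order a^(sp) · a^(-d), the second factor being a
Jacobian (`lintegral_twoMean_sub_le`). Since sp > d, the changes sum over dyadic scales
(`lintegral_scaleVariation_le`), and at almost every y the sum bounds the distance from F(y) to the
mean (`ae_enorm_sub_twoMean_le`).

For Δ_h^r F(x), the means at the points x + kh are taken with the same random pair at scale τ
comparable to |h|. Contracting an arithmetic progression gives another one, so the r-th difference
of the means is a combination of r-th differences of F with fixed shorter steps and random bases.
Both contributions have p-th moment of order |h|^(sp-d), whence |Δ_h^r F| ≤ M|h|^(s-d/p) almost
everywhere for each h (`ae_enorm_diff_rpow_le`). For p = ∞ this is the hypothesis itself.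

Averaging `shiftMean` over one random point then approximates F uniformly by continuous functions,
which produces the continuous representative (`LipDiffBound.exists_continuousOn`). For p < 1 the
integrability needed here comes from an a.e. bound on F (`LipDiffBound.exists_ae_norm_le`).
Continuity removes the exceptional null sets, contraction towards the center reaches the boundary
(`LipDiffBound.norm_diff_le`), and repeated halving treats long steps
(`norm_diff_le_of_norm_le_two_pow`). -/

/-! ### Algebra of finite differences and shift means. -/

/-- The combination of forward translates of `F` whose error is the `r`-th difference. -/
def shiftMean {d : ℕ} (r : ℕ) (v : E d) (F : E d → ℝ) (y : E d) : ℝ :=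
  ∑ j ∈ Finset.Icc 1 r, (-1) ^ (j + 1) * (r.choose j : ℝ) * F (y + (j : ℝ) • v)

theorem diff_eq_sum_real {d : ℕ} (r : ℕ) (h : E d) (f : E d → ℝ) (x : E d) :
    diff r h f x =
      (-1) ^ r * ∑ k ∈ Finset.range (r + 1),
        (-1) ^ k * (r.choose k : ℝ) * f (x + (k : ℝ) • h) := by
  simp only [diff_eq_sum, Nat.cast_smul_eq_nsmul]

theorem sum_range_succ_eq_Icc (r : ℕ) (u : ℕ → ℝ) :
    ∑ k ∈ Finset.range (r + 1), u k = u 0 + ∑ k ∈ Finset.Icc 1 r, u k := by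
  rw [Finset.range_eq_Ico, Finset.sum_eq_sum_Ico_succ_bot (Nat.succ_pos r)]
  rfl

theorem sub_shiftMean {d : ℕ} (r : ℕ) (v : E d) (F : E d → ℝ) (y : E d) :
    F y - shiftMean r v F y = (-1) ^ r * diff r v F y := by
  have h1 : ((-1 : ℝ)) ^ r * (-1) ^ r = 1 := by rw [← mul_pow]; simp
  rw [diff_eq_sum_real, ← mul_assoc, h1, one_mul, sum_range_succ_eq_Icc, shiftMean, sub_eq_add_neg,
    ← Finset.sum_neg_distrib]
  congr 1
  · simp
  · exact Finset.sum_congr rfl fun j _ => by ring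

/-- With T the translation by v, T² - 1 = (T - 1)(T + 1). The r-th power of the commuting factor T +
1 is expanded binomially. -/
theorem diff_two_smul {d : ℕ} (r : ℕ) (v : E d) (F : E d → ℝ) (y : E d) :
    diff r ((2 : ℝ) • v) F y =
      ∑ j ∈ Finset.range (r + 1), (r.choose j : ℝ) * diff r v F (y + (j : ℝ) • v) := by
  have h1 : fwdDiff_aux.fwdDiffₗ (E d) ℝ ((2 : ℝ) • v) =
      fwdDiff_aux.fwdDiffₗ (E d) ℝ v * (fwdDiff_aux.shiftₗ (E d) ℝ v + 1) := by
    refine LinearMap.ext fun g => funext fun x => ?_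
    have h2 : x + (2 : ℝ) • v = x + v + v := by module
    simp [fwdDiff_aux.fwdDiffₗ, fwdDiff_aux.shiftₗ, fwdDiff, h2]
    ring
  have hc : Commute (fwdDiff_aux.fwdDiffₗ (E d) ℝ v) (fwdDiff_aux.shiftₗ (E d) ℝ v + 1) := by
    have h3 : Commute (fwdDiff_aux.fwdDiffₗ (E d) ℝ v) (fwdDiff_aux.fwdDiffₗ (E d) ℝ v) :=
      Commute.refl _
    exact (h3.add_right (Commute.one_right _)).add_right (Commute.one_right _)
  have h4 : (fwdDiff ((2 : ℝ) • v))^[r] F =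
      ((fwdDiff_aux.shiftₗ (E d) ℝ v + 1) ^ r * fwdDiff_aux.fwdDiffₗ (E d) ℝ v ^ r) F := by
    rw [← fwdDiff_aux.coe_fwdDiffₗ_pow, h1, hc.mul_pow, (hc.pow_pow r r).eq]
  rw [diff, h4, (Commute.one_right (fwdDiff_aux.shiftₗ (E d) ℝ v)).add_pow]
  simp only [one_pow, mul_one, Module.End.mul_apply, LinearMap.sum_apply, Finset.sum_apply]
  refine Finset.sum_congr rfl fun j _ => ?_
  have h5 : ((r.choose j : Module.End ℤ (E d → ℝ))) ((fwdDiff_aux.fwdDiffₗ (E d) ℝ v ^ r) F)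
      = (r.choose j : ℝ) • diff r v F := by
    rw [Module.End.natCast_apply, diff, ← fwdDiff_aux.coe_fwdDiffₗ_pow, Nat.cast_smul_eq_nsmul]
  rw [h5, fwdDiff_aux.shiftₗ_pow_apply, Pi.smul_apply, smul_eq_mul, Nat.cast_smul_eq_nsmul]

/-- The change of `shiftMean` when the step is doubled. -/
theorem shiftMean_two_smul_sub {d : ℕ} (r : ℕ) (v : E d) (F : E d → ℝ) (y : E d) :
    shiftMean r ((2 : ℝ) • v) F y - shiftMean r v F y =
      -(-1) ^ r * ∑ j ∈ Finset.Icc 1 r, (r.choose j : ℝ) * diff r v F (y + (j : ℝ) • v) := by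
  have h1 := sub_shiftMean r v F y
  have h2 := sub_shiftMean r ((2 : ℝ) • v) F y
  rw [diff_two_smul, sum_range_succ_eq_Icc] at h2
  simp only [Nat.choose_zero_right, Nat.cast_one, Nat.cast_zero, zero_smul, add_zero, one_mul]
    at h2
  linarith

theorem shiftMean_comm {d : ℕ} (r : ℕ) (v w : E d) (F : E d → ℝ) (y : E d) :
    shiftMean r v (shiftMean r w F) y = shiftMean r w (shiftMean r v F) y := by
  simp only [shiftMean, Finset.mul_sum]
  rw [Finset.sum_comm]
  refine Finset.sum_congr rfl fun i _ => Finset.sum_congr rfl fun j _ => ?_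
  rw [add_right_comm]
  ring

theorem shiftMean_sub {d : ℕ} (r : ℕ) (v : E d) (F G : E d → ℝ) (y : E d) :
    shiftMean r v F y - shiftMean r v G y = shiftMean r v (fun x => F x - G x) y := by
  simp only [shiftMean, ← Finset.sum_sub_distrib]
  exact Finset.sum_congr rfl fun i _ => by ring

theorem enorm_choose_mul_le (r j : ℕ) (a x : ℝ) (ha : |a| = 1) :
    ‖a * (r.choose j : ℝ) * x‖ₑ ≤ 2 ^ r * ‖x‖ₑ := by
  have h1 : ‖a‖ₑ = 1 := by rw [← enorm_norm, Real.norm_eq_abs, ha]; simp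
  have h2 : ‖(r.choose j : ℝ)‖ₑ ≤ 2 ^ r := by
    have h3 : ‖(r.choose j : ℝ)‖ₑ = (r.choose j : ℝ≥0∞) := by
      rw [Real.enorm_of_nonneg (Nat.cast_nonneg _), ENNReal.ofReal_natCast]
    rw [h3]
    exact_mod_cast Nat.choose_le_two_pow r j
  rw [enorm_mul, enorm_mul, h1, one_mul]
  gcongr

theorem enorm_shiftMean_le {d : ℕ} (r : ℕ) (v : E d) (F : E d → ℝ) (y : E d) :
    ‖shiftMean r v F y‖ₑ ≤ 2 ^ r * ∑ j ∈ Finset.Icc 1 r, ‖F (y + (j : ℝ) • v)‖ₑ := by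
  rw [Finset.mul_sum]
  exact (enorm_sum_le _ _).trans
    (Finset.sum_le_sum fun j _ => enorm_choose_mul_le r j _ _ (by simp))

theorem enorm_shiftMean_two_smul_sub_le {d : ℕ} (r : ℕ) (v : E d) (F : E d → ℝ) (y : E d) :
    ‖shiftMean r ((2 : ℝ) • v) F y - shiftMean r v F y‖ₑ ≤
      2 ^ r * ∑ j ∈ Finset.Icc 1 r, ‖diff r v F (y + (j : ℝ) • v)‖ₑ := by
  rw [shiftMean_two_smul_sub, Finset.mul_sum, Finset.mul_sum]
  refine (enorm_sum_le _ _).trans (Finset.sum_le_sum fun j _ => ?_)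
  rw [← mul_assoc]
  exact enorm_choose_mul_le r j _ _ (by simp)

/-- The change of the two-step mean along `v` and `w` when both steps are doubled. -/
theorem enorm_shiftMean_shiftMean_two_smul_sub_le {d : ℕ} (r : ℕ) (v w : E d) (F : E d → ℝ)
    (y : E d) :
    ‖shiftMean r ((2 : ℝ) • v) (shiftMean r ((2 : ℝ) • w) F) y
        - shiftMean r v (shiftMean r w F) y‖ₑ ≤
      4 ^ r * ∑ j ∈ Finset.Icc 1 r, ∑ i ∈ Finset.Icc 1 r,
        (‖diff r w F (y + (j : ℝ) • (2 : ℝ) • v + (i : ℝ) • w)‖ₑ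
          + ‖diff r v F (y + (j : ℝ) • w + (i : ℝ) • v)‖ₑ) := by
  -- The inner step is doubled first, then the outer one. Commuting the means lets each error be a
  -- difference along one direction, averaged over shifts in the other.
  have h1 : shiftMean r ((2 : ℝ) • v) (shiftMean r ((2 : ℝ) • w) F) y
        - shiftMean r v (shiftMean r w F) y
      = shiftMean r ((2 : ℝ) • v)
          (fun x => shiftMean r ((2 : ℝ) • w) F x - shiftMean r w F x) y
        + shiftMean r w (fun x => shiftMean r ((2 : ℝ) • v) F x - shiftMean r v F x) y := by
    rw [← shiftMean_sub, ← shiftMean_sub, shiftMean_comm r w ((2 : ℝ) • v),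
      shiftMean_comm r w v]
    ring
  have h2 : ∀ a b : E d, ∀ G : E d → ℝ, (∀ x, ‖G x‖ₑ ≤
        2 ^ r * ∑ i ∈ Finset.Icc 1 r, ‖diff r b F (x + (i : ℝ) • b)‖ₑ) →
      ‖shiftMean r a G y‖ₑ ≤ 4 ^ r * ∑ j ∈ Finset.Icc 1 r, ∑ i ∈ Finset.Icc 1 r,
        ‖diff r b F (y + (j : ℝ) • a + (i : ℝ) • b)‖ₑ := by
    intro a b G hG
    have h4 : (4 : ℝ≥0∞) ^ r = 2 ^ r * 2 ^ r := by rw [← mul_pow]; norm_num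
    refine (enorm_shiftMean_le r a G y).trans ?_
    rw [h4, mul_assoc]
    gcongr
    rw [Finset.mul_sum]
    exact Finset.sum_le_sum fun j _ => hG _
  rw [h1]
  refine (enorm_add_le _ _).trans ?_
  simp only [Finset.sum_add_distrib, mul_add]
  exact add_le_add (h2 _ _ _ fun x => enorm_shiftMean_two_smul_sub_le r w F x)
    (h2 _ _ _ fun x => enorm_shiftMean_two_smul_sub_le r v F x)

/-! ### Power inequalities valid for every exponent p > 0. -/

/-- The power of a finite sum is at most a constant times the sum of the powers. -/
theorem rpow_sum_le {ι : Type*} (S : Finset ι) (a : ι → ℝ≥0∞) {p : ℝ} (hp : 0 < p) :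
    (∑ i ∈ S, a i) ^ p ≤ (S.card : ℝ≥0∞) ^ p * ∑ i ∈ S, a i ^ p := by
  -- Each term is at most the ℓ_p quasi-norm; no convexity is used, so p < 1 is allowed.
  have h1 : ∑ i ∈ S, a i ≤ S.card * (∑ i ∈ S, a i ^ p) ^ (1 / p) := by
    rw [← nsmul_eq_mul]
    refine Finset.sum_le_card_nsmul _ _ _ fun i hi => ?_
    rw [one_div, ENNReal.le_rpow_inv_iff hp]
    exact Finset.single_le_sum (f := fun i => a i ^ p) (fun _ _ => zero_le) hi
  refine (ENNReal.rpow_le_rpow h1 hp.le).trans ?_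
  rw [ENNReal.mul_rpow_of_nonneg _ _ hp.le, ← ENNReal.rpow_mul, one_div_mul_cancel hp.ne',
    ENNReal.rpow_one]

theorem rpow_add_le (a b : ℝ≥0∞) {p : ℝ} (hp : 0 < p) :
    (a + b) ^ p ≤ 2 ^ p * (a ^ p + b ^ p) := by
  simpa using rpow_sum_le Finset.univ ![a, b] hp

/-- A weighted series version of `rpow_sum_le`. -/
theorem exists_rpow_tsum_le {p δ : ℝ} (hp : 0 < p) (hδ : 0 < δ) :
    ∃ K : ℝ≥0, ∀ a : ℕ → ℝ≥0∞,
      (∑' n, a n) ^ p ≤ K * ∑' n : ℕ, ENNReal.ofReal (2 ^ (δ * n)) * a n ^ p := by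
  -- This ratio makes every term at most q^n times the 1/p-th power of the weighted sum, so a
  -- geometric series remains.
  set q : ℝ := 2 ^ (-(δ / p)) with hq
  have hq0 : 0 < q := by positivity
  have hq1 : q < 1 := Real.rpow_lt_one_of_one_lt_of_neg (by norm_num) (by
    have := div_pos hδ hp; linarith)
  have hsum : Summable fun n : ℕ => q ^ n := summable_geometric_of_lt_one hq0.le hq1
  refine ⟨(∑' n : ℕ, q ^ n).toNNReal ^ p, fun a => ?_⟩
  set S : ℝ≥0∞ := ∑' n : ℕ, ENNReal.ofReal (2 ^ (δ * n)) * a n ^ p with hS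
  have h1 : ∀ n, a n ≤ ENNReal.ofReal (q ^ n) * S ^ (1 / p) := by
    intro n
    have h2 : ENNReal.ofReal (2 ^ (δ * n)) * a n ^ p ≤ S :=
      ENNReal.le_tsum (f := fun n : ℕ => ENNReal.ofReal (2 ^ (δ * n)) * a n ^ p) n
    have h3 : ENNReal.ofReal (q ^ n) * (ENNReal.ofReal (2 ^ (δ * n)) * a n ^ p) ^ (1 / p)
        = a n := by
      rw [ENNReal.mul_rpow_of_nonneg _ _ (by positivity), ← ENNReal.rpow_mul,
        mul_one_div_cancel hp.ne', ENNReal.rpow_one, ENNReal.ofReal_rpow_of_pos (by positivity),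
        ← mul_assoc, ← ENNReal.ofReal_mul (by positivity), hq, ← Real.rpow_natCast,
        ← Real.rpow_mul (by norm_num), ← Real.rpow_mul (by norm_num),
        ← Real.rpow_add (by norm_num)]
      have : -(δ / p) * n + δ * n * (1 / p) = 0 := by ring
      rw [this]; simp
    rw [← h3]
    gcongr
  have h4 : ∑' n, a n ≤ ENNReal.ofReal (∑' n : ℕ, q ^ n) * S ^ (1 / p) := by
    rw [ENNReal.ofReal_tsum_of_nonneg (fun n => by positivity) hsum, ← ENNReal.tsum_mul_right]
    exact ENNReal.tsum_le_tsum h1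
  refine (ENNReal.rpow_le_rpow h4 hp.le).trans (le_of_eq ?_)
  rw [ENNReal.mul_rpow_of_nonneg _ _ hp.le, ← ENNReal.rpow_mul, one_div_mul_cancel hp.ne',
    ENNReal.rpow_one, ENNReal.coe_rpow_of_nonneg _ hp.le]
  rfl

/-! ### Geometry of the cube and affine changes of variables. -/

theorem isOpen_openCube (d : ℕ) : IsOpen (openCube d) := by
  have h : openCube d = ⋂ i, (fun x : E d => x i) ⁻¹' Ioo (0 : ℝ) 1 := by
    ext x; simp [openCube]
  rw [h]
  exact isOpen_iInter_of_finite fun i => isOpen_Ioo.preimage (by fun_prop)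

theorem measurableSet_openCube (d : ℕ) : MeasurableSet (openCube d) :=
  (isOpen_openCube d).measurableSet

theorem convex_openCube (d : ℕ) : Convex ℝ (openCube d) := by
  intro x hx y hy a b ha hb hab i
  simpa using convex_Ioo (0 : ℝ) 1 (hx i) (hy i) ha hb hab

theorem convex_closedCube (d : ℕ) : Convex ℝ (closedCube d) := by
  intro x hx y hy a b ha hb hab i
  simpa using convex_Icc (0 : ℝ) 1 (hx i) (hy i) ha hb hab

theorem openCube_subset_closedCube (d : ℕ) : openCube d ⊆ closedCube d :=
  fun _ hx i => Ioo_subset_Icc_self (hx i)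

theorem volume_openCube (d : ℕ) : volume (openCube d) = 1 := by
  have h : openCube d = (WithLp.ofLp : E d → Fin d → ℝ) ⁻¹' (univ.pi fun _ => Ioo (0 : ℝ) 1) := by
    ext x; simp [openCube]
  rw [h, (PiLp.volume_preserving_ofLp (Fin d)).measure_preimage
    (MeasurableSet.univ_pi fun _ => measurableSet_Ioo).nullMeasurableSet, Real.volume_pi_Ioo]
  simp

instance isProbabilityMeasure_openCube (d : ℕ) :
    IsProbabilityMeasure (volume.restrict (openCube d)) :=
  ⟨by simp [volume_openCube]⟩

/-- The center of the cube. -/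
def center (d : ℕ) : E d := WithLp.toLp 2 fun _ => 1 / 2

theorem center_mem (d : ℕ) : center d ∈ openCube d := fun i => by
  simp only [center, mem_Ioo]; norm_num

/-- Contracting the closed cube towards an interior point. -/
theorem contract_mem {d : ℕ} {x z : E d} (hx : x ∈ closedCube d) (hz : z ∈ openCube d) {ε : ℝ}
    (h0 : 0 < ε) (h1 : ε ≤ 1) : (1 - ε) • x + ε • z ∈ openCube d := by
  intro i
  have hx' := hx i
  have hz' := hz i
  simp only [mem_Icc, mem_Ioo, PiLp.add_apply, PiLp.smul_apply, smul_eq_mul] at *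
  constructor
  · nlinarith [mul_nonneg (sub_nonneg.2 h1) hx'.1, mul_pos h0 hz'.1]
  · nlinarith [mul_le_mul_of_nonneg_left hx'.2 (sub_nonneg.2 h1), mul_lt_mul_of_pos_left hz'.2 h0]

theorem closedCube_subset_closure (d : ℕ) : closedCube d ⊆ closure (openCube d) := by
  intro x hx
  have h : Filter.Tendsto (fun ε : ℝ => (1 - ε) • x + ε • center d) (nhdsWithin 0 (Ioc 0 1))
      (nhds x) := by
    have h1 : Continuous fun ε : ℝ => (1 - ε) • x + ε • center d := by fun_prop
    have h2 := h1.tendsto 0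
    simp only [sub_zero, one_smul, zero_smul, add_zero] at h2
    exact h2.mono_left nhdsWithin_le_nhds
  have : (nhdsWithin (0 : ℝ) (Ioc 0 1)).NeBot := by
    rw [← mem_closure_iff_nhdsWithin_neBot, closure_Ioc (by norm_num)]
    simp
  exact mem_closure_of_tendsto h (Filter.eventually_of_mem self_mem_nhdsWithin
    fun ε hε => contract_mem hx (center_mem d) hε.1 hε.2)

theorem mem_shrink_iff {d : ℕ} {S : Set (E d)} (hS : Convex ℝ S) {x v : E d} :
    x ∈ shrink S v ↔ x ∈ S ∧ x + v ∈ S :=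
  ⟨fun h => ⟨h.1, h.2 (right_mem_segment ℝ _ _)⟩, fun h => ⟨h.1, hS.segment_subset h.1 h.2⟩⟩

theorem shrink_openCube_eq {d : ℕ} (v : E d) :
    shrink (openCube d) v = openCube d ∩ (fun x => x + v) ⁻¹' openCube d := by
  ext x
  exact mem_shrink_iff (convex_openCube d)

theorem isOpen_shrink_openCube {d : ℕ} (v : E d) : IsOpen (shrink (openCube d) v) := by
  rw [shrink_openCube_eq]
  exact (isOpen_openCube d).inter ((isOpen_openCube d).preimage (by fun_prop))

theorem measurableSet_shrink_openCube {d : ℕ} (v : E d) :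
    MeasurableSet (shrink (openCube d) v) :=
  (isOpen_shrink_openCube v).measurableSet

theorem add_smul_mem_of_mem_shrink {d : ℕ} {S : Set (E d)} {r k : ℕ} {x h : E d}
    (hx : x ∈ shrink S ((r : ℝ) • h)) (hk : k ≤ r) : x + (k : ℝ) • h ∈ S := by
  rcases Nat.eq_zero_or_pos r with rfl | hr
  · obtain rfl : k = 0 := by omega
    simpa using hx.1
  refine hx.2 ?_
  rw [segment_eq_image']
  have hr' : (0 : ℝ) < r := by exact_mod_cast hr
  refine ⟨(k : ℝ) / r, ⟨by positivity, ?_⟩, ?_⟩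
  · rw [div_le_one hr']; exact_mod_cast hk
  · simp only [add_sub_cancel_left, smul_smul]
    rw [div_mul_cancel₀ _ hr'.ne']

/-- The crude bound d in place of √d keeps later smallness conditions free of roots. -/
theorem norm_sub_le_of_mem_closedCube {d : ℕ} {x y : E d} (hx : x ∈ closedCube d)
    (hy : y ∈ closedCube d) : ‖x - y‖ ≤ d := by
  rw [EuclideanSpace.norm_eq]
  refine Real.sqrt_le_iff.2 ⟨by positivity, ?_⟩
  have h1 : ∑ i, ‖(x - y) i‖ ^ 2 ≤ ∑ _i : Fin d, (1 : ℝ) := by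
    refine Finset.sum_le_sum fun i _ => ?_
    have hx' := hx i
    have hy' := hy i
    simp only [mem_Icc, PiLp.sub_apply, Real.norm_eq_abs, sq_abs] at *
    rw [sq_le_one_iff_abs_le_one, abs_le]
    constructor <;> linarith
  refine h1.trans ?_
  simp only [Finset.sum_const, Finset.card_univ, Fintype.card_fin, nsmul_eq_mul, mul_one]
  rcases Nat.eq_zero_or_pos d with rfl | hd
  · simp
  · have : (1 : ℝ) ≤ d := by exact_mod_cast hd
    nlinarith

theorem lintegral_comp_affine {d : ℕ} (q : E d) {c : ℝ} (hc : 0 < c) (ψ : E d → ℝ≥0∞) :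
    ∫⁻ z, ψ (q + c • z) = ENNReal.ofReal (c ^ (-(d : ℝ))) * ∫⁻ x, ψ x := by
  have h1 := lintegral_map_equiv (μ := (volume : Measure (E d))) (fun x => ψ (q + x))
    (Homeomorph.smulOfNeZero c hc.ne').toMeasurableEquiv
  have h2 : Measure.map (Homeomorph.smulOfNeZero c hc.ne').toMeasurableEquiv
      (volume : Measure (E d)) = ENNReal.ofReal (c ^ (-(d : ℝ))) • volume := by
    have h3 := Measure.map_addHaar_smul (volume : Measure (E d)) hc.ne'
    rw [finrank_euclideanSpace_fin, abs_of_pos (by positivity)] at h3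
    rw [Real.rpow_neg hc.le, Real.rpow_natCast, ← h3]
    rfl
  rw [h2, lintegral_smul_measure, lintegral_add_left_eq_self] at h1
  exact h1.symm

/-- The Jacobian c^(-d) is the source of the loss d/p in the smoothness exponent. -/
theorem setLIntegral_comp_affine_le {d : ℕ} (q : E d) {c : ℝ} (hc : 0 < c) {S T : Set (E d)}
    (hS : MeasurableSet S) (hT : MeasurableSet T) (hST : ∀ z ∈ S, q + c • z ∈ T)
    (ψ : E d → ℝ≥0∞) :
    ∫⁻ z in S, ψ (q + c • z) ≤ ENNReal.ofReal (c ^ (-(d : ℝ))) * ∫⁻ x in T, ψ x := by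
  rw [← lintegral_indicator hT, ← lintegral_comp_affine q hc, ← lintegral_indicator hS]
  refine lintegral_mono fun z => ?_
  by_cases hz : z ∈ S
  · simp [hz, hST z hz]
  · simp [hz]

theorem quasiMeasurePreserving_affine {d : ℕ} (q : E d) {c : ℝ} (hc : c ≠ 0) :
    Measure.QuasiMeasurePreserving (fun z : E d => q + c • z) volume volume := by
  have h1 : Measure.QuasiMeasurePreserving (fun z : E d => c • z) volume volume := by
    refine ⟨by fun_prop, ?_⟩
    rw [Measure.map_addHaar_smul _ hc]
    exact Measure.smul_absolutelyContinuous
  exact (measurePreserving_add_left volume q).quasiMeasurePreserving.comp h1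

theorem measurable_diff {d : ℕ} {r : ℕ} {F : E d → ℝ} (hF : Measurable F) :
    Measurable fun a : E d × E d => diff r a.1 F a.2 := by
  simp only [diff_eq_sum_real]
  fun_prop

/-! ### Moment estimates with random base points. -/

/-- The `p`-th power form of `ω_r(F, t)_p ^ p ≤ N t^{s p}` for `0 < t ≤ 1`. -/
def DiffBound {d : ℕ} (r : ℕ) (p s : ℝ) (N : ℝ≥0∞) (F : E d → ℝ) : Prop :=
  ∀ t ∈ Ioc (0 : ℝ) 1, ∀ h : E d, ‖h‖ ≤ t →
    ∫⁻ x in shrink (openCube d) ((r : ℝ) • h), ‖diff r h F x‖ₑ ^ p ≤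
      N * ENNReal.ofReal (t ^ (s * p))

/-- The point is the convex combination of y, z, z' with weights 1 - α - β, α, β. -/
theorem add_smul_sub_add_smul_sub_mem {d : ℕ} {y z z' : E d} (hy : y ∈ openCube d)
    (hz : z ∈ openCube d) (hz' : z' ∈ openCube d) {α β : ℝ} (hα : 0 ≤ α) (hβ : 0 ≤ β)
    (h : α + β ≤ 1) : y + α • (z - y) + β • (z' - y) ∈ openCube d := by
  have h1 := (convex_openCube d).sum_mem (t := Finset.univ) (w := ![1 - α - β, α, β])
    (z := ![y, z, z']) (by intro i _; fin_cases i <;> simp <;> linarith)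
    (by simp [Fin.sum_univ_three]; ring) (by intro i _; fin_cases i <;> simpa)
  simp only [Fin.sum_univ_three, Matrix.cons_val_zero, Matrix.cons_val_one,
    Matrix.cons_val] at h1
  convert h1 using 1
  module

/-- The basic averaging estimate: a random base point and a fixed step. -/
theorem lintegral_diff_random_base_le {d : ℕ} (hd : 1 ≤ d) {r : ℕ} {p s : ℝ} {N : ℝ≥0∞}
    {F : E d → ℝ} (hN : DiffBound r p s N F) {y b : E d} (hy : y ∈ openCube d)
    (hb : b ∈ openCube d) {a κ : ℝ} (ha : 0 < a) (haκ : a ≤ κ) (had : a * d ≤ 1) {i : ℕ}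
    (hκ : κ + (i + r) * a ≤ 1) :
    ∫⁻ z in openCube d,
      ‖diff r (a • (b - y)) F (y + κ • (z - y) + (i : ℝ) • a • (b - y))‖ₑ ^ p ≤
      N * ENNReal.ofReal (d ^ (s * p) * a ^ (s * p - d)) := by
  have hd' : (0 : ℝ) < d := by exact_mod_cast hd
  have hκ0 : 0 < κ := ha.trans_le haκ
  set w := a • (b - y) with hw
  have h1 : ∀ z ∈ openCube d, (y - κ • y + (i : ℝ) • w) + κ • z ∈
      shrink (openCube d) ((r : ℝ) • w) := by
    intro z hz
    rw [mem_shrink_iff (convex_openCube d)]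
    have hr0 : (0 : ℝ) ≤ r := by positivity
    have hi0 : (0 : ℝ) ≤ i := by positivity
    constructor
    · convert add_smul_sub_add_smul_sub_mem hy hz hb hκ0.le (β := i * a) (by positivity)
        (by nlinarith [mul_nonneg hr0 ha.le]) using 1
      rw [hw]; module
    · convert add_smul_sub_add_smul_sub_mem hy hz hb hκ0.le (β := (i + r) * a) (by positivity)
        hκ using 1
      rw [hw]; module
  have h2 := setLIntegral_comp_affine_le (y - κ • y + (i : ℝ) • w) hκ0
    (measurableSet_openCube d) (measurableSet_shrink_openCube _) h1
    (fun x => ‖diff r w F x‖ₑ ^ p)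
  have h3 : ‖w‖ ≤ a * d := by
    rw [hw, norm_smul, Real.norm_of_nonneg ha.le]
    gcongr
    exact norm_sub_le_of_mem_closedCube (openCube_subset_closedCube d hb)
      (openCube_subset_closedCube d hy)
  -- Using a * d rather than ‖w‖ as the scale gives a bound independent of b, and a positive scale
  -- even when b = y.
  have h4 := hN (a * d) ⟨by positivity, had⟩ w h3
  have h5 : ∀ z, y + κ • (z - y) + (i : ℝ) • w = (y - κ • y + (i : ℝ) • w) + κ • z :=
    fun z => by module
  simp only [h5]
  refine h2.trans ((mul_le_mul' (ENNReal.ofReal_le_ofReal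
    (Real.rpow_le_rpow_of_nonpos ha haκ (by simp))) h4).trans (le_of_eq ?_))
  rw [mul_left_comm, ← ENNReal.ofReal_mul (by positivity)]
  congr 2
  rw [Real.mul_rpow ha.le hd'.le, sub_eq_add_neg, Real.rpow_add ha]
  ring

/-- The two-step mean of `F` at `y` in direction of the points `z.1`, `z.2`. -/
def twoMean {d : ℕ} (r : ℕ) (F : E d → ℝ) (y : E d) (a : ℝ) (z : E d × E d) : ℝ :=
  shiftMean r (a • (z.1 - y)) (shiftMean r (a • (z.2 - y)) F) y

theorem measurable_twoMean {d : ℕ} {r : ℕ} {F : E d → ℝ} (hF : Measurable F) (y : E d) (a : ℝ) :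
    Measurable (twoMean r F y a) := by
  unfold twoMean shiftMean
  fun_prop

theorem measurable_diff_comp {d : ℕ} {X : Type*} [MeasurableSpace X] {r : ℕ} {F : E d → ℝ}
    (hF : Measurable F) {u v : X → E d} (hu : Measurable u) (hv : Measurable v) :
    Measurable fun x => diff r (u x) F (v x) :=
  (measurable_diff hF).comp (hu.prodMk hv)

/-- Pairs of independent uniformly distributed points of the cube. -/
abbrev pairs (d : ℕ) : Measure (E d × E d) :=
  (volume.restrict (openCube d)).prod (volume.restrict (openCube d))

/-- Tonelli with the second point frozen; the bound survives integration because the cube has volume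
one. -/
theorem lintegral_pairs_le_of_fst {d : ℕ} {ψ : E d × E d → ℝ≥0∞} (hψ : Measurable ψ) {B : ℝ≥0∞}
    (h : ∀ b ∈ openCube d, ∫⁻ z in openCube d, ψ (z, b) ≤ B) : ∫⁻ z, ψ z ∂pairs d ≤ B := by
  rw [lintegral_prod_symm' _ hψ]
  refine (setLIntegral_mono' (measurableSet_openCube d) h).trans ?_
  simp

theorem lintegral_pairs_le_of_snd {d : ℕ} {ψ : E d × E d → ℝ≥0∞} (hψ : Measurable ψ) {B : ℝ≥0∞}
    (h : ∀ b ∈ openCube d, ∫⁻ z in openCube d, ψ (b, z) ≤ B) : ∫⁻ z, ψ z ∂pairs d ≤ B := by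
  rw [lintegral_prod _ hψ.aemeasurable]
  refine (setLIntegral_mono' (measurableSet_openCube d) h).trans ?_
  simp

/-- In every error term one random point fixes the step, of length at most a * d, and the other
moves the base by a multiple of at least a. The former gives a^(sp), the latter costs at most
a^(-d). -/
theorem lintegral_twoMean_sub_le {d : ℕ} (hd : 1 ≤ d) (r : ℕ) {p : ℝ} (hp : 0 < p) (s : ℝ) :
    ∃ K : ℝ≥0, ∀ (F : E d → ℝ) (N : ℝ≥0∞), Measurable F → DiffBound r p s N F →
      ∀ y ∈ openCube d, ∀ a : ℝ, 0 < a → a * d ≤ 1 → 4 * r * a ≤ 1 →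
        ∫⁻ z, ‖twoMean r F y (2 * a) z - twoMean r F y a z‖ₑ ^ p ∂pairs d ≤
          K * (N * ENNReal.ofReal (a ^ (s * p - d))) := by
  set I := Finset.Icc 1 r ×ˢ Finset.Icc 1 r with hI
  set K : ℝ≥0∞ := (4 ^ r) ^ p * ((I.card : ℝ≥0∞) ^ p *
    (I.card * (2 ^ p * (2 * ENNReal.ofReal (d ^ (s * p)))))) with hK
  have hKt : K ≠ ∞ := by
    have h1 : ((4 : ℝ≥0∞) ^ r) ^ p ≠ ∞ := ENNReal.rpow_ne_top_of_nonneg hp.le (by simp)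
    have h2 : ((I.card : ℝ≥0∞)) ^ p ≠ ∞ := ENNReal.rpow_ne_top_of_nonneg hp.le (by simp)
    have h3 : (2 : ℝ≥0∞) ^ p ≠ ∞ := ENNReal.rpow_ne_top_of_nonneg hp.le (by simp)
    have h4 : (I.card : ℝ≥0∞) ≠ ∞ := ENNReal.natCast_ne_top _
    have h5 : (2 : ℝ≥0∞) ≠ ∞ := by simp
    exact ENNReal.mul_ne_top h1 (ENNReal.mul_ne_top h2 (ENNReal.mul_ne_top h4
      (ENNReal.mul_ne_top h3 (ENNReal.mul_ne_top h5 ENNReal.ofReal_ne_top))))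
  refine ⟨K.toNNReal, fun F N hF hN y hy a ha had har => ?_⟩
  rw [ENNReal.coe_toNNReal hKt]
  set B := N * ENNReal.ofReal (d ^ (s * p) * a ^ (s * p - d)) with hB
  set U : ℕ × ℕ → E d × E d → ℝ≥0∞ := fun q z =>
    ‖diff r (a • (z.2 - y)) F
      (y + (2 * (q.1 * a)) • (z.1 - y) + (q.2 : ℝ) • a • (z.2 - y))‖ₑ with hU
  set V : ℕ × ℕ → E d × E d → ℝ≥0∞ := fun q z =>
    ‖diff r (a • (z.1 - y)) F
      (y + (q.1 * a) • (z.2 - y) + (q.2 : ℝ) • a • (z.1 - y))‖ₑ with hV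
  have hUm : ∀ q, Measurable fun z => U q z ^ p := fun q =>
    (measurable_diff_comp hF (by fun_prop) (by fun_prop)).enorm.pow_const p
  have hVm : ∀ q, Measurable fun z => V q z ^ p := fun q =>
    (measurable_diff_comp hF (by fun_prop) (by fun_prop)).enorm.pow_const p
  have hr0 : (0 : ℝ) ≤ r := by positivity
  have hbd : ∀ q ∈ I, (1 : ℝ) ≤ q.1 ∧ (q.1 : ℝ) ≤ r ∧ (q.2 : ℝ) ≤ r := by
    intro q hq
    simp only [hI, Finset.mem_product, Finset.mem_Icc] at hq
    exact ⟨by exact_mod_cast hq.1.1, by exact_mod_cast hq.1.2, by exact_mod_cast hq.2.2⟩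
  have hUi : ∀ q ∈ I, ∫⁻ z, U q z ^ p ∂pairs d ≤ B := by
    intro q hq
    obtain ⟨h1, h2, h3⟩ := hbd q hq
    refine lintegral_pairs_le_of_fst (hUm q) fun b hb => ?_
    -- The worst total weight is 2ra for the displacement plus (r + r)a along the step, hence the
    -- requirement 4ra ≤ 1.
    exact lintegral_diff_random_base_le hd hN hy hb ha (by nlinarith) had (by nlinarith)
  have hVi : ∀ q ∈ I, ∫⁻ z, V q z ^ p ∂pairs d ≤ B := by
    intro q hq
    obtain ⟨h1, h2, h3⟩ := hbd q hq
    refine lintegral_pairs_le_of_snd (hVm q) fun b hb => ?_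
    exact lintegral_diff_random_base_le hd hN hy hb ha (by nlinarith) had (by nlinarith)
  have hpt : ∀ z, ‖twoMean r F y (2 * a) z - twoMean r F y a z‖ₑ ^ p ≤
      (4 ^ r) ^ p * ((I.card : ℝ≥0∞) ^ p * ∑ q ∈ I, 2 ^ p * (U q z ^ p + V q z ^ p)) := by
    intro z
    have h1 := enorm_shiftMean_shiftMean_two_smul_sub_le r (a • (z.1 - y)) (a • (z.2 - y)) F y
    have h2 : ‖twoMean r F y (2 * a) z - twoMean r F y a z‖ₑ ≤
        4 ^ r * ∑ q ∈ I, (U q z + V q z) := by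
      simp only [twoMean, mul_smul]
      refine h1.trans (le_of_eq ?_)
      rw [hI, Finset.sum_product]
      refine congrArg _ (Finset.sum_congr rfl fun j _ => Finset.sum_congr rfl fun i _ => ?_)
      simp only [hU, hV]
      congr 5 <;> module
    refine (ENNReal.rpow_le_rpow h2 hp.le).trans ?_
    rw [ENNReal.mul_rpow_of_nonneg _ _ hp.le]
    gcongr
    refine (rpow_sum_le I _ hp).trans ?_
    gcongr
    exact rpow_add_le _ _ hp
  refine (lintegral_mono hpt).trans ?_
  have hUVm : ∀ q, Measurable fun z => 2 ^ p * (U q z ^ p + V q z ^ p) := fun q =>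
    ((hUm q).add (hVm q)).const_mul _
  have hsm : Measurable fun z => ∑ q ∈ I, 2 ^ p * (U q z ^ p + V q z ^ p) :=
    Finset.measurable_fun_sum I fun q _ => hUVm q
  rw [lintegral_const_mul _ (hsm.const_mul _), lintegral_const_mul _ hsm,
    lintegral_finsetSum _ fun q _ => hUVm q]
  have h6 : ∀ q ∈ I, ∫⁻ z, 2 ^ p * (U q z ^ p + V q z ^ p) ∂pairs d ≤ 2 ^ p * (2 * B) := by
    intro q hq
    rw [lintegral_const_mul' _ _ (ENNReal.rpow_ne_top_of_nonneg hp.le (by simp)), lintegral_add_left (hUm q), two_mul B]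
    gcongr
    · exact hUi q hq
    · exact hVi q hq
  have h7 := Finset.sum_le_card_nsmul I _ _ h6
  rw [nsmul_eq_mul] at h7
  refine (mul_le_mul_right (mul_le_mul_right h7 _) _).trans (le_of_eq ?_)
  rw [hB, hK, ENNReal.ofReal_mul (by positivity)]
  ring

/-! ### Summation over dyadic scales. -/

/-- The total variation of the two-step means over the scales `τ, τ / 2, τ / 4, …`. -/
def scaleVariation {d : ℕ} (r : ℕ) (F : E d → ℝ) (y : E d) (τ : ℝ) (z : E d × E d) : ℝ≥0∞ :=
  ∑' n : ℕ, ‖twoMean r F y (τ / 2 ^ n) z - twoMean r F y (τ / 2 ^ (n + 1)) z‖ₑ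

theorem measurable_scaleVariation {d : ℕ} {r : ℕ} {F : E d → ℝ} (hF : Measurable F) (y : E d)
    (τ : ℝ) : Measurable (scaleVariation r F y τ) :=
  Measurable.tsum fun _ =>
    ((measurable_twoMean hF y _).sub (measurable_twoMean hF y _)).enorm

theorem lintegral_scaleVariation_le {d : ℕ} (hd : 1 ≤ d) (r : ℕ) {p : ℝ} (hp : 0 < p) {s : ℝ}
    (hs : (d : ℝ) < s * p) :
    ∃ K : ℝ≥0, ∀ (F : E d → ℝ) (N : ℝ≥0∞), Measurable F → DiffBound r p s N F →
      ∀ y ∈ openCube d, ∀ τ : ℝ, 0 < τ → τ * d ≤ 1 → 2 * r * τ ≤ 1 →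
        ∫⁻ z, scaleVariation r F y τ z ^ p ∂pairs d ≤
          K * (N * ENNReal.ofReal (τ ^ (s * p - d))) := by
  obtain ⟨K₁, hK₁⟩ := lintegral_twoMean_sub_le hd r hp s
  -- Half of the surplus sp - d pays for the weights that move the p-th power inside the series; the
  -- other half leaves geometric decay.
  set δ := (s * p - d) / 2 with hδ
  have hδ0 : 0 < δ := by rw [hδ]; linarith
  obtain ⟨K₂, hK₂⟩ := exists_rpow_tsum_le hp hδ0
  set q : ℝ := 2 ^ (-δ) with hq
  have hq0 : 0 < q := by positivity
  have hq1 : q < 1 := Real.rpow_lt_one_of_one_lt_of_neg (by norm_num) (by linarith)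
  have hsum : Summable fun n : ℕ => q ^ n := summable_geometric_of_lt_one hq0.le hq1
  refine ⟨K₂ * K₁ * (∑' n : ℕ, q ^ n).toNNReal, fun F N hF hN y hy τ hτ hτd hτr => ?_⟩
  have hm : ∀ n : ℕ, Measurable fun z =>
      ‖twoMean r F y (τ / 2 ^ n) z - twoMean r F y (τ / 2 ^ (n + 1)) z‖ₑ ^ p := fun n =>
    ((measurable_twoMean hF y _).sub (measurable_twoMean hF y _)).enorm.pow_const p
  have h1 : ∀ n : ℕ, ENNReal.ofReal (2 ^ (δ * n)) * ∫⁻ z,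
      ‖twoMean r F y (τ / 2 ^ n) z - twoMean r F y (τ / 2 ^ (n + 1)) z‖ₑ ^ p ∂pairs d ≤
        ENNReal.ofReal (q ^ n) * (K₁ * (N * ENNReal.ofReal (τ ^ (s * p - d)))) := by
    intro n
    have h2n : (1 : ℝ) ≤ 2 ^ n := one_le_pow₀ (by norm_num)
    have hle : τ / 2 ^ (n + 1) ≤ τ / 2 := by
      rw [pow_succ]
      gcongr
      linarith
    have hd0 : (0 : ℝ) ≤ d := by positivity
    have hr0 : (0 : ℝ) ≤ r := by positivity
    -- The smaller scale is at most τ / 2, so 2rτ ≤ 1 supplies the condition with the factor 4.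
    have h2 := hK₁ F N hF hN y hy (τ / 2 ^ (n + 1)) (by positivity)
      (by nlinarith) (by nlinarith)
    have h3 : 2 * (τ / 2 ^ (n + 1)) = τ / 2 ^ n := by rw [pow_succ]; field_simp
    rw [h3] at h2
    refine (mul_le_mul_right h2 _).trans ?_
    rw [mul_left_comm, mul_left_comm (ENNReal.ofReal (q ^ n))]
    gcongr (K₁ : ℝ≥0∞) * ?_
    rw [mul_left_comm, mul_left_comm (ENNReal.ofReal (q ^ n))]
    gcongr N * ?_
    rw [← ENNReal.ofReal_mul (by positivity), ← ENNReal.ofReal_mul (by positivity)]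
    refine ENNReal.ofReal_le_ofReal ?_
    rw [Real.div_rpow hτ.le (by positivity), mul_div_left_comm, mul_comm]
    gcongr
    rw [hq, ← Real.rpow_natCast, ← Real.rpow_natCast, ← Real.rpow_mul (by norm_num),
      ← Real.rpow_mul (by norm_num), ← Real.rpow_sub (by norm_num)]
    refine Real.rpow_le_rpow_of_exponent_le (by norm_num) ?_
    push_cast
    rw [show s * p - d = 2 * δ by rw [hδ]; ring]
    nlinarith
  calc ∫⁻ z, scaleVariation r F y τ z ^ p ∂pairs d
      ≤ ∫⁻ z, K₂ * ∑' n : ℕ, ENNReal.ofReal (2 ^ (δ * n)) *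
          ‖twoMean r F y (τ / 2 ^ n) z - twoMean r F y (τ / 2 ^ (n + 1)) z‖ₑ ^ p ∂pairs d :=
        lintegral_mono fun z => hK₂ _
    _ = K₂ * ∑' n : ℕ, ENNReal.ofReal (2 ^ (δ * n)) * ∫⁻ z,
          ‖twoMean r F y (τ / 2 ^ n) z - twoMean r F y (τ / 2 ^ (n + 1)) z‖ₑ ^ p ∂pairs d := by
        rw [lintegral_const_mul' _ _ ENNReal.coe_ne_top,
          lintegral_tsum fun n => ((hm n).const_mul _).aemeasurable]
        simp only [lintegral_const_mul' _ _ ENNReal.ofReal_ne_top]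
    _ ≤ K₂ * ∑' n : ℕ, ENNReal.ofReal (q ^ n) *
          (K₁ * (N * ENNReal.ofReal (τ ^ (s * p - d)))) := by
        exact mul_le_mul_right (ENNReal.tsum_le_tsum h1) _
    _ = _ := by
        rw [ENNReal.tsum_mul_right, ← ENNReal.ofReal_tsum_of_nonneg (fun n => by positivity) hsum]
        push_cast
        rw [← ENNReal.ofReal]
        ring

theorem enorm_twoMean_sub_twoMean_le {d : ℕ} (r : ℕ) (F : E d → ℝ) (y : E d) (τ : ℝ)
    (z : E d × E d) (n : ℕ) :
    ‖twoMean r F y τ z - twoMean r F y (τ / 2 ^ n) z‖ₑ ≤ scaleVariation r F y τ z := by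
  have h1 : twoMean r F y τ z - twoMean r F y (τ / 2 ^ n) z = ∑ k ∈ Finset.range n,
      (twoMean r F y (τ / 2 ^ k) z - twoMean r F y (τ / 2 ^ (k + 1)) z) := by
    rw [Finset.sum_range_sub' (fun k => twoMean r F y (τ / 2 ^ k) z)]
    simp
  rw [h1]
  exact (enorm_sum_le _ _).trans (ENNReal.sum_le_tsum _)

/-! ### Recovery of F from its means at points of approximate continuity. -/

/-- For r ≥ 1 an r-th difference annihilates constants, so the coefficients of the mean sum to one.
-/
theorem shiftMean_const {d : ℕ} {r : ℕ} (hr : 1 ≤ r) (v : E d) (c : ℝ) (y : E d) :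
    shiftMean r v (fun _ => c) y = c := by
  have h := sub_shiftMean r v (fun _ => c) y
  have h2 : diff r v (fun _ => c) y = 0 := by
    obtain ⟨k, rfl⟩ : ∃ k, r = k + 1 := ⟨r - 1, by omega⟩
    rw [diff, Function.iterate_succ_apply, fwdDiff_const]
    have : ∀ k : ℕ, (fwdDiff v)^[k] (fun _ : E d => (0 : ℝ)) = fun _ => 0 := by
      intro k
      induction k with
      | zero => rfl
      | succ k ih => rw [Function.iterate_succ_apply, fwdDiff_const, ih]
    rw [this]
  rw [h2] at h
  linarith

theorem twoMean_eq_sum {d : ℕ} (r : ℕ) (F : E d → ℝ) (y : E d) (a : ℝ) (z : E d × E d) :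
    twoMean r F y a z = ∑ j ∈ Finset.Icc 1 r, ∑ i ∈ Finset.Icc 1 r,
      ((-1) ^ (j + 1) * (r.choose j : ℝ)) * (((-1) ^ (i + 1) * (r.choose i : ℝ)) *
        F (y + (j * a) • (z.1 - y) + (i * a) • (z.2 - y))) := by
  simp only [twoMean, shiftMean, Finset.mul_sum, smul_smul]

/-- Points of approximate continuity, in terms of the bounded function `arctan ∘ F`. -/
def IsApproxPoint {d : ℕ} (F : E d → ℝ) (y : E d) : Prop :=
  Filter.Tendsto (fun ρ : ℝ =>
    (∫⁻ x in Metric.closedBall y ρ, ‖Real.arctan (F x) - Real.arctan (F y)‖ₑ) /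
      volume (Metric.closedBall y ρ)) (nhdsWithin 0 (Ioi 0)) (nhds 0)

/-- Lebesgue differentiation needs local integrability, which an L_p function with p < 1 may lack;
arctan ∘ F is bounded and always qualifies. -/
theorem ae_isApproxPoint {d : ℕ} {F : E d → ℝ} (hF : Measurable F) :
    ∀ᵐ y, IsApproxPoint F y := by
  have hb : LocallyIntegrable (fun x => Real.arctan (F x)) (volume : Measure (E d)) := by
    refine (locallyIntegrable_const (Real.pi / 2)).mono
      (Real.measurable_arctan.comp hF).aestronglyMeasurable (Filter.Eventually.of_forall fun x => ?_)
    rw [Real.norm_eq_abs, Real.norm_of_nonneg (by positivity), abs_le]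
    exact ⟨(Real.neg_pi_div_two_lt_arctan _).le, (Real.arctan_lt_pi_div_two _).le⟩
  filter_upwards [(Besicovitch.vitaliFamily (volume : Measure (E d))).ae_tendsto_lintegral_enorm_sub_div
    hb] with y hy
  exact hy.comp (Besicovitch.tendsto_filterAt volume y)

theorem norm_two_step_le {d : ℕ} {y z z' : E d} (hy : y ∈ openCube d) (hz : z ∈ openCube d)
    (hz' : z' ∈ openCube d) {α β : ℝ} (hα : 0 ≤ α) (hβ : 0 ≤ β) :
    ‖α • (z - y) + β • (z' - y)‖ ≤ (α + β) * d := by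
  have h : ∀ w ∈ openCube d, ‖w - y‖ ≤ d := fun w hw =>
    norm_sub_le_of_mem_closedCube (openCube_subset_closedCube d hw)
      (openCube_subset_closedCube d hy)
  refine (norm_add_le _ _).trans ?_
  rw [norm_smul, norm_smul, Real.norm_of_nonneg hα, Real.norm_of_nonneg hβ, add_mul]
  gcongr
  · exact h z hz
  · exact h z' hz'

/-- Near a point of approximate continuity the values at random two-step points converge. -/
theorem tendsto_lintegral_arctan_sub {d : ℕ} (hd : 1 ≤ d) {r : ℕ} {F : E d → ℝ}
    (hF : Measurable F) {y : E d} (hy : y ∈ openCube d) (hyF : IsApproxPoint F y) {τ : ℝ}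
    (hτ : 0 < τ) {j i : ℕ} (hj : j ∈ Finset.Icc 1 r) (hi : i ∈ Finset.Icc 1 r) :
    Filter.Tendsto (fun n : ℕ => ∫⁻ z, ‖Real.arctan (F (y + (j * (τ / 2 ^ n)) • (z.1 - y)
      + (i * (τ / 2 ^ n)) • (z.2 - y))) - Real.arctan (F y)‖ₑ ∂pairs d)
      Filter.atTop (nhds 0) := by
  rw [Finset.mem_Icc] at hj hi
  have hj1 : (1 : ℝ) ≤ j := by exact_mod_cast hj.1
  have hjr : (j : ℝ) ≤ r := by exact_mod_cast hj.2
  have hir : (i : ℝ) ≤ r := by exact_mod_cast hi.2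
  have hd' : (0 : ℝ) < d := by exact_mod_cast hd
  have hr : (0 : ℝ) < r := by linarith
  -- All two-step points at scale a lie within distance (j + i)ad ≤ c * a of y.
  set c : ℝ := 2 * r * d with hc
  have hc0 : 0 < c := by positivity
  have ha0 : ∀ n : ℕ, 0 < τ / 2 ^ n := fun n => by positivity
  have hlim : Filter.Tendsto (fun n : ℕ => c * (τ / 2 ^ n)) Filter.atTop
      (nhdsWithin 0 (Ioi 0)) := by
    refine tendsto_nhdsWithin_iff.2 ⟨?_, Filter.Eventually.of_forall fun n =>
      mul_pos hc0 (ha0 n)⟩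
    have h1 : Filter.Tendsto (fun n : ℕ => c * τ * (1 / 2 : ℝ) ^ n) Filter.atTop
        (nhds (c * τ * 0)) :=
      (tendsto_pow_atTop_nhds_zero_of_lt_one (by norm_num) (by norm_num)).const_mul _
    rw [mul_zero] at h1
    refine h1.congr fun n => ?_
    rw [one_div, inv_pow]
    ring
  set D : ℝ≥0∞ := ENNReal.ofReal (c ^ d) * volume (Metric.ball (0 : E d) 1) with hD
  have hDt : D ≠ ∞ := ENNReal.mul_ne_top ENNReal.ofReal_ne_top measure_ball_lt_top.ne
  have h0 := ENNReal.Tendsto.const_mul (hyF.comp hlim) (Or.inr hDt)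
  rw [mul_zero] at h0
  refine tendsto_of_tendsto_of_tendsto_of_le_of_le tendsto_const_nhds h0 (fun _ => zero_le)
    fun n => ?_
  set a := τ / 2 ^ n with ha
  have han : 0 < a := ha0 n
  have hm : Measurable fun z : E d × E d => ‖Real.arctan (F (y + (j * a) • (z.1 - y)
      + (i * a) • (z.2 - y))) - Real.arctan (F y)‖ₑ := by
    fun_prop
  refine lintegral_pairs_le_of_fst hm fun b hb => ?_
  have h1 := setLIntegral_comp_affine_le (y - (j * a) • y + (i * a) • (b - y))
    (c := j * a) (by positivity) (measurableSet_openCube d)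
    (Metric.isClosed_closedBall (x := y) (ε := c * a)).measurableSet (fun z hz => by
      rw [mem_closedBall_iff_norm]
      have h2 := norm_two_step_le hy hz hb (α := j * a) (β := i * a) (by positivity)
        (by positivity)
      have h3 : (j * a + i * a) * d ≤ c * a := by
        rw [hc]
        have : (j * a + i * a) * d = (j + i) * (a * d) := by ring
        rw [this, show 2 * r * d * a = (r + r) * (a * d) by ring]
        gcongr
      refine le_trans (le_of_eq ?_) (h2.trans h3)
      congr 1
      module) (fun x => ‖Real.arctan (F x) - Real.arctan (F y)‖ₑ)
  have h4 : ∀ z, y + (j * a) • (z - y) + (i * a) • (b - y) =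
      (y - (j * a) • y + (i * a) • (b - y)) + (j * a) • z := fun z => by module
  simp only [h4]
  refine h1.trans ?_
  -- The ball has volume a constant multiple of a^d, which cancels the Jacobian and leaves the mean
  -- oscillation.
  have hv : volume (Metric.closedBall y (c * a)) = ENNReal.ofReal (a ^ (d : ℝ)) * D := by
    rw [Measure.addHaar_closedBall _ _ (by positivity), finrank_euclideanSpace_fin, hD,
      ← mul_assoc, ← ENNReal.ofReal_mul (by positivity), Real.rpow_natCast, mul_pow, mul_comm]
    ring_nf
  have hvpos : volume (Metric.closedBall y (c * a)) ≠ 0 :=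
    (Metric.measure_closedBall_pos volume y (by positivity)).ne'
  have hvt : volume (Metric.closedBall y (c * a)) ≠ ∞ := measure_closedBall_lt_top.ne
  simp only [Function.comp]
  set J := ∫⁻ x in Metric.closedBall y (c * a), ‖Real.arctan (F x) - Real.arctan (F y)‖ₑ
  have h5 : J = ENNReal.ofReal (a ^ (d : ℝ)) * D * (J / volume (Metric.closedBall y (c * a))) := by
    rw [← hv, ENNReal.mul_div_cancel hvpos hvt]
  calc ENNReal.ofReal ((j * a) ^ (-(d : ℝ))) * J
      ≤ ENNReal.ofReal (a ^ (-(d : ℝ))) * J := by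
        refine mul_le_mul_left (ENNReal.ofReal_le_ofReal
          (Real.rpow_le_rpow_of_nonpos han (by nlinarith) (by simp))) _
    _ = D * (J / volume (Metric.closedBall y (c * a))) := by
        nth_rw 1 [h5]
        rw [← mul_assoc, ← mul_assoc, ← ENNReal.ofReal_mul (by positivity),
          ← Real.rpow_add han]
        simp

/-- At points of approximate continuity, `F` differs from its two-step mean by at most the total
variation of the means. -/
theorem ae_enorm_sub_twoMean_le {d : ℕ} (hd : 1 ≤ d) {r : ℕ} (hr : 1 ≤ r) {F : E d → ℝ}
    (hF : Measurable F) {y : E d} (hy : y ∈ openCube d) (hyF : IsApproxPoint F y) {τ : ℝ}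
    (hτ : 0 < τ) :
    ∀ᵐ z ∂pairs d, ‖F y - twoMean r F y τ z‖ₑ ≤ scaleVariation r F y τ z := by
  set I := Finset.Icc 1 r ×ˢ Finset.Icc 1 r with hI
  set P : ℕ → ℕ × ℕ → E d × E d → E d := fun n q z =>
    y + (q.1 * (τ / 2 ^ n)) • (z.1 - y) + (q.2 * (τ / 2 ^ n)) • (z.2 - y) with hP
  set G : ℕ → E d × E d → ℝ≥0∞ := fun n z =>
    ∑ q ∈ I, ‖Real.arctan (F (P n q z)) - Real.arctan (F y)‖ₑ with hG
  have hGq : ∀ n q, Measurable fun z => ‖Real.arctan (F (P n q z)) - Real.arctan (F y)‖ₑ :=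
    fun n q => by simp only [hP]; fun_prop
  have hGm : ∀ n, Measurable (G n) := fun n => Finset.measurable_fun_sum _ fun q _ => hGq n q
  have hGlim : Filter.Tendsto (fun n => ∫⁻ z, G n z ∂pairs d) Filter.atTop (nhds 0) := by
    have h1 : ∀ n, ∫⁻ z, G n z ∂pairs d =
        ∑ q ∈ I, ∫⁻ z, ‖Real.arctan (F (P n q z)) - Real.arctan (F y)‖ₑ ∂pairs d :=
      fun n => lintegral_finsetSum _ fun q _ => hGq n q
    simp only [h1]
    rw [← Finset.sum_const_zero (s := I) (M := ℝ≥0∞)]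
    refine tendsto_finsetSum _ fun q hq => ?_
    rw [hI, Finset.mem_product] at hq
    exact tendsto_lintegral_arctan_sub hd hF hy hyF hτ hq.1 hq.2
  -- Fatou turns convergence of the integrals into a vanishing lower limit at almost every z.
  have hzero : ∀ᵐ z ∂pairs d, Filter.liminf (fun n => G n z) Filter.atTop = 0 := by
    have h1 := lintegral_liminf_le (μ := pairs d) (u := Filter.atTop) hGm
    rw [hGlim.liminf_eq, nonpos_iff_eq_zero,
      lintegral_eq_zero_iff (Measurable.liminf hGm)] at h1
    exact h1
  filter_upwards [hzero] with z hz
  have hcl : MapClusterPt 0 Filter.atTop fun n => G n z := by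
    rw [mapClusterPt_iff_frequently]
    intro S hS
    obtain ⟨ε, hε, hεS⟩ := ENNReal.nhds_zero_basis.mem_iff.1 hS
    exact (Filter.frequently_lt_of_liminf_lt (by isBoundedDefault) (hz.trans_lt hε)).mono
      fun n hn => hεS hn
  -- Convergence along one ultrafilter is enough, because the bound by the total variation holds at
  -- every scale.
  obtain ⟨U, hU, hGU⟩ := mapClusterPt_iff_ultrafilter.1 hcl
  have hFq : ∀ q ∈ I, Filter.Tendsto (fun n => F (P n q z)) U (nhds (F y)) := by
    intro q hq
    have h1 : Filter.Tendsto (fun n => ‖Real.arctan (F (P n q z)) - Real.arctan (F y)‖ₑ) U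
        (nhds 0) :=
      tendsto_of_tendsto_of_tendsto_of_le_of_le tendsto_const_nhds hGU (fun _ => zero_le)
        fun n => Finset.single_le_sum
          (f := fun q => ‖Real.arctan (F (P n q z)) - Real.arctan (F y)‖ₑ)
          (fun _ _ => zero_le) hq
    have h2 : Filter.Tendsto (fun n => Real.arctan (F (P n q z))) U
        (nhds (Real.arctan (F y))) := by
      rw [tendsto_iff_edist_tendsto_0]
      simpa only [edist_eq_enorm_sub] using h1
    have h3 := ((Real.continuousAt_tan.2 (Real.cos_arctan_pos (F y)).ne').tendsto).comp h2
    simpa only [Function.comp_def, Real.tan_arctan] using h3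
  have hT : Filter.Tendsto (fun n => twoMean r F y (τ / 2 ^ n) z) U (nhds (F y)) := by
    have h1 : F y = ∑ j ∈ Finset.Icc 1 r, ∑ i ∈ Finset.Icc 1 r,
      ((-1) ^ (j + 1) * (r.choose j : ℝ)) * (((-1) ^ (i + 1) * (r.choose i : ℝ)) * F y) := by
      have h2 := twoMean_eq_sum r (fun _ => F y) y τ z
      have h3 : twoMean r (fun _ => F y) y τ z = F y := by
        have h4 : shiftMean r (τ • (z.2 - y)) (fun _ => F y) = fun _ => F y :=
          funext fun x => shiftMean_const hr _ _ _
        rw [twoMean, h4, shiftMean_const hr]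
      rw [h3] at h2
      exact h2
    simp only [twoMean_eq_sum]
    rw [h1]
    refine tendsto_finsetSum _ fun j hj => tendsto_finsetSum _ fun i hi => ?_
    exact ((hFq (j, i) (Finset.mem_product.2 ⟨hj, hi⟩)).const_mul _).const_mul _
  have hlim : Filter.Tendsto (fun n => ‖twoMean r F y τ z - twoMean r F y (τ / 2 ^ n) z‖ₑ) U
      (nhds ‖twoMean r F y τ z - F y‖ₑ) :=
    (tendsto_const_nhds.sub hT).enorm
  rw [enorm_sub_rev]
  exact le_of_tendsto hlim (Filter.Eventually.of_forall fun n =>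
    enorm_twoMean_sub_twoMean_le r F y τ z n)

/-! ### The pointwise bound for differences. -/

/-- The `r`-th difference of the two-step means, with base points in arithmetic progression. -/
theorem sum_twoMean_eq {d : ℕ} (r : ℕ) (F : E d → ℝ) (x h : E d) (τ : ℝ) (z : E d × E d) :
    (-1) ^ r * ∑ k ∈ Finset.range (r + 1), (-1) ^ k * (r.choose k : ℝ) *
        twoMean r F (x + (k : ℝ) • h) τ z =
      ∑ j ∈ Finset.Icc 1 r, ∑ i ∈ Finset.Icc 1 r,
        ((-1) ^ (j + 1) * (r.choose j : ℝ)) * (((-1) ^ (i + 1) * (r.choose i : ℝ)) *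
          diff r ((1 - (j + i) * τ) • h) F
            (x + (j * τ) • (z.1 - x) + (i * τ) • (z.2 - x))) := by
  simp only [twoMean_eq_sum, diff_eq_sum_real, Finset.mul_sum]
  rw [Finset.sum_comm]
  refine Finset.sum_congr rfl fun j _ => ?_
  rw [Finset.sum_comm]
  refine Finset.sum_congr rfl fun i _ => Finset.sum_congr rfl fun k _ => ?_
  have h1 : x + (k : ℝ) • h + (j * τ) • (z.1 - (x + (k : ℝ) • h))
        + (i * τ) • (z.2 - (x + (k : ℝ) • h)) =
      x + (j * τ) • (z.1 - x) + (i * τ) • (z.2 - x)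
        + (k : ℝ) • (1 - (j + i) * τ) • h := by module
  rw [h1]
  ring

/-- F is split at each x + kh into its deviation from the mean and the mean itself. Sharing the pair
z among all k makes the second part a combination of differences of F. -/
theorem enorm_diff_le {d : ℕ} (r : ℕ) (F : E d → ℝ) (x h : E d) (τ : ℝ) (z : E d × E d) :
    ‖diff r h F x‖ₑ ≤
      2 ^ r * ∑ k ∈ Finset.range (r + 1),
        ‖F (x + (k : ℝ) • h) - twoMean r F (x + (k : ℝ) • h) τ z‖ₑ +
      4 ^ r * ∑ q ∈ Finset.Icc 1 r ×ˢ Finset.Icc 1 r,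
        ‖diff r ((1 - (q.1 + q.2) * τ) • h) F
            (x + (q.1 * τ) • (z.1 - x) + (q.2 * τ) • (z.2 - x))‖ₑ := by
  have h1 : diff r h F x = (-1) ^ r * ∑ k ∈ Finset.range (r + 1), (-1) ^ k * (r.choose k : ℝ) *
        (F (x + (k : ℝ) • h) - twoMean r F (x + (k : ℝ) • h) τ z) +
      (-1) ^ r * ∑ k ∈ Finset.range (r + 1), (-1) ^ k * (r.choose k : ℝ) *
        twoMean r F (x + (k : ℝ) • h) τ z := by
    rw [diff_eq_sum_real, ← mul_add, ← Finset.sum_add_distrib]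
    congr 1
    exact Finset.sum_congr rfl fun k _ => by ring
  rw [h1, sum_twoMean_eq]
  refine (enorm_add_le _ _).trans (add_le_add ?_ ?_)
  · rw [Finset.mul_sum, Finset.mul_sum]
    refine (enorm_sum_le _ _).trans (Finset.sum_le_sum fun k _ => ?_)
    rw [← mul_assoc, ← mul_assoc]
    exact enorm_choose_mul_le r k _ _ (by simp [abs_mul])
  · rw [Finset.sum_product, Finset.mul_sum]
    refine (enorm_sum_le _ _).trans (Finset.sum_le_sum fun j _ => ?_)
    rw [Finset.mul_sum]
    refine (enorm_sum_le _ _).trans (Finset.sum_le_sum fun i _ => ?_)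
    have h4 : (4 : ℝ≥0∞) ^ r = 2 ^ r * 2 ^ r := by rw [← mul_pow]; norm_num
    rw [h4, mul_assoc (2 ^ r : ℝ≥0∞)]
    refine (enorm_choose_mul_le r j ((-1) ^ (j + 1)) _ (by simp)).trans (mul_le_mul_right ?_ _)
    exact enorm_choose_mul_le r i ((-1) ^ (i + 1)) _ (by simp)

/-- Contraction towards the random points replaces h by a multiple that does not depend on them,
while z.1 spreads the base point at a cost of at most τ^(-d). The condition 2rτ ≤ 1 keeps the
multiple nonnegative. -/
theorem lintegral_diff_contracted_le {d : ℕ} {r : ℕ} {p s : ℝ} {N : ℝ≥0∞} {F : E d → ℝ}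
    (hF : Measurable F) (hN : DiffBound r p s N F) {x h : E d} (h0 : h ≠ 0) (h1 : ‖h‖ ≤ 1)
    (hx : x ∈ shrink (openCube d) ((r : ℝ) • h)) {τ : ℝ} (hτ : 0 < τ) (hτr : 2 * r * τ ≤ 1)
    {j i : ℕ} (hj : j ∈ Finset.Icc 1 r) (hi : i ∈ Finset.Icc 1 r) :
    ∫⁻ z, ‖diff r ((1 - (j + i) * τ) • h) F
        (x + (j * τ) • (z.1 - x) + (i * τ) • (z.2 - x))‖ₑ ^ p ∂pairs d ≤
      N * ENNReal.ofReal (τ ^ (-(d : ℝ)) * ‖h‖ ^ (s * p)) := by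
  rw [Finset.mem_Icc] at hj hi
  have hj1 : (1 : ℝ) ≤ j := by exact_mod_cast hj.1
  have hjr : (j : ℝ) ≤ r := by exact_mod_cast hj.2
  have hir : (i : ℝ) ≤ r := by exact_mod_cast hi.2
  have hi0 : (0 : ℝ) ≤ i := by positivity
  rw [mem_shrink_iff (convex_openCube d)] at hx
  set c : ℝ := 1 - (j + i) * τ with hc
  have hc0 : 0 ≤ c := by nlinarith
  have hc1 : c ≤ 1 := by nlinarith
  refine lintegral_pairs_le_of_fst
    ((measurable_diff_comp hF (by fun_prop) (by fun_prop)).enorm.pow_const p) fun b hb => ?_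
  have hmem : ∀ y ∈ openCube d, ∀ z ∈ openCube d,
      c • y + (j * τ) • z + (i * τ) • b ∈ openCube d := by
    intro y hy z hz
    convert add_smul_sub_add_smul_sub_mem hy hz hb (α := j * τ) (β := i * τ) (by positivity)
      (by positivity) (by nlinarith) using 1
    rw [hc]; module
  have h2 := setLIntegral_comp_affine_le (c • x + (i * τ) • b) (c := j * τ) (by positivity)
    (measurableSet_openCube d) (measurableSet_shrink_openCube ((r : ℝ) • c • h))
    (fun z hz => by
      rw [mem_shrink_iff (convex_openCube d)]
      constructor
      · convert hmem x hx.1 z hz using 1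
        module
      · convert hmem _ hx.2 z hz using 1
        module) (fun y => ‖diff r (c • h) F y‖ₑ ^ p)
  have h3 : ∀ z, x + (j * τ) • (z - x) + (i * τ) • (b - x) =
      (c • x + (i * τ) • b) + (j * τ) • z := fun z => by rw [hc]; module
  simp only [h3]
  have hch : ‖c • h‖ ≤ ‖h‖ := by
    rw [norm_smul, Real.norm_of_nonneg hc0]
    exact mul_le_of_le_one_left (norm_nonneg _) hc1
  refine h2.trans ((mul_le_mul' (ENNReal.ofReal_le_ofReal (Real.rpow_le_rpow_of_nonpos hτ
    (by nlinarith) (by simp))) (hN ‖h‖ ⟨norm_pos_iff.2 h0, h1⟩ _ hch)).trans (le_of_eq ?_))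
  rw [mul_left_comm, ← ENNReal.ofReal_mul (by positivity)]

/-- The embedding on the level of differences: an `L_p` bound of order `s` for the differences
gives a pointwise bound of order `s - d / p`. -/
theorem ae_enorm_diff_rpow_le {d : ℕ} (hd : 1 ≤ d) {r : ℕ} (hr : 1 ≤ r) {p : ℝ} (hp : 0 < p)
    {s : ℝ} (hs : (d : ℝ) < s * p) :
    ∃ K : ℝ≥0, ∀ (F : E d → ℝ) (N : ℝ≥0∞), Measurable F → DiffBound r p s N F →
      ∀ h : E d, h ≠ 0 → ‖h‖ ≤ 1 → ∀ᵐ x, x ∈ shrink (openCube d) ((r : ℝ) • h) →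
        ‖diff r h F x‖ₑ ^ p ≤ K * (N * ENNReal.ofReal (‖h‖ ^ (s * p - d))) := by
  obtain ⟨K₁, hK₁⟩ := lintegral_scaleVariation_le hd r hp hs
  have hd1 : (1 : ℝ) ≤ d := by exact_mod_cast hd
  have hr1 : (1 : ℝ) ≤ r := by exact_mod_cast hr
  set I := Finset.Icc 1 r ×ˢ Finset.Icc 1 r with hI
  -- With τ = κ‖h‖ both smallness conditions hold for ‖h‖ ≤ 1, and both contributions scale like
  -- ‖h‖^(sp-d).
  set κ : ℝ := 1 / (2 * r * d) with hκ
  have hκ0 : 0 < κ := by positivity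
  set B₁ : ℝ≥0∞ := (2 ^ r) ^ p * (((r + 1 : ℕ) : ℝ≥0∞) ^ p * ((r + 1 : ℕ) *
    (K₁ * ENNReal.ofReal (κ ^ (s * p - d))))) with hB₁
  set B₂ : ℝ≥0∞ := (4 ^ r) ^ p * ((I.card : ℝ≥0∞) ^ p * (I.card *
    ENNReal.ofReal (κ ^ (-(d : ℝ))))) with hB₂
  have hfin : ∀ m : ℕ, (m : ℝ≥0∞) ^ p ≠ ∞ := fun m =>
    ENNReal.rpow_ne_top_of_nonneg hp.le (ENNReal.natCast_ne_top m)
  have hK : 2 ^ p * (B₁ + B₂) ≠ ∞ := by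
    have h2 := hfin 2
    have h3 := hfin (2 ^ r)
    have h4 := hfin (4 ^ r)
    push_cast at h2 h3 h4
    refine ENNReal.mul_ne_top h2 (ENNReal.add_ne_top.2 ⟨?_, ?_⟩)
    · exact ENNReal.mul_ne_top h3 (ENNReal.mul_ne_top (hfin _) (ENNReal.mul_ne_top
        (ENNReal.natCast_ne_top _) (ENNReal.mul_ne_top ENNReal.coe_ne_top ENNReal.ofReal_ne_top)))
    · exact ENNReal.mul_ne_top h4 (ENNReal.mul_ne_top (hfin _) (ENNReal.mul_ne_top
        (ENNReal.natCast_ne_top _) ENNReal.ofReal_ne_top))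
  refine ⟨(2 ^ p * (B₁ + B₂)).toNNReal, fun F N hF hN h h0 h1 => ?_⟩
  rw [ENNReal.coe_toNNReal hK]
  have hgood : ∀ᵐ x, ∀ k : ℕ, IsApproxPoint F (x + (k : ℝ) • h) :=
    ae_all_iff.2 fun k =>
      (measurePreserving_add_right volume ((k : ℝ) • h)).quasiMeasurePreserving.ae
        (ae_isApproxPoint hF)
  filter_upwards [hgood] with x hxg hx
  have hh : 0 < ‖h‖ := norm_pos_iff.2 h0
  set τ : ℝ := κ * ‖h‖ with hτ
  have hτ0 : 0 < τ := by positivity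
  have hτd : τ * d ≤ 1 := by
    have : τ * d = ‖h‖ * (1 / (2 * r)) := by rw [hτ, hκ]; field_simp
    rw [this]
    refine mul_le_one₀ h1 (by positivity) ?_
    rw [div_le_one (by positivity)]; linarith
  have hτr : 2 * r * τ ≤ 1 := by
    have : 2 * r * τ = ‖h‖ * (1 / d) := by rw [hτ, hκ]; field_simp
    rw [this]
    refine mul_le_one₀ h1 (by positivity) ?_
    rwa [div_le_one (by positivity)]
  have hyk : ∀ k ∈ Finset.range (r + 1), x + (k : ℝ) • h ∈ openCube d := fun k hk =>
    add_smul_mem_of_mem_shrink hx (Nat.lt_succ_iff.1 (Finset.mem_range.1 hk))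
  set W : ℕ × ℕ → E d × E d → ℝ≥0∞ := fun q z => ‖diff r ((1 - (q.1 + q.2) * τ) • h) F
    (x + (q.1 * τ) • (z.1 - x) + (q.2 * τ) • (z.2 - x))‖ₑ with hW
  have hWm : ∀ q, Measurable fun z => W q z ^ p := fun q =>
    (measurable_diff_comp hF (by fun_prop) (by fun_prop)).enorm.pow_const p
  have hRm : ∀ k : ℕ, Measurable fun z => scaleVariation r F (x + (k : ℝ) • h) τ z ^ p :=
    fun k => (measurable_scaleVariation hF _ _).pow_const p
  have hae : ∀ᵐ z ∂pairs d, ∀ k ∈ Finset.range (r + 1),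
      ‖F (x + (k : ℝ) • h) - twoMean r F (x + (k : ℝ) • h) τ z‖ₑ ≤
        scaleVariation r F (x + (k : ℝ) • h) τ z :=
    (ae_ball_iff (Finset.countable_toSet _)).2 fun k hk =>
      ae_enorm_sub_twoMean_le hd hr hF (hyk k hk) (hxg k) hτ0
  have hpt : ∀ᵐ z ∂pairs d, ‖diff r h F x‖ₑ ^ p ≤ 2 ^ p *
      ((2 ^ r) ^ p * (((r + 1 : ℕ) : ℝ≥0∞) ^ p *
        ∑ k ∈ Finset.range (r + 1), scaleVariation r F (x + (k : ℝ) • h) τ z ^ p) +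
      (4 ^ r) ^ p * ((I.card : ℝ≥0∞) ^ p * ∑ q ∈ I, W q z ^ p)) := by
    filter_upwards [hae] with z hz
    refine (ENNReal.rpow_le_rpow ((enorm_diff_le r F x h τ z).trans (add_le_add
      (mul_le_mul_right (Finset.sum_le_sum hz) _) le_rfl)) hp.le).trans ?_
    refine (rpow_add_le _ _ hp).trans ?_
    rw [ENNReal.mul_rpow_of_nonneg _ _ hp.le, ENNReal.mul_rpow_of_nonneg _ _ hp.le]
    gcongr
    · refine (rpow_sum_le _ _ hp).trans (le_of_eq ?_)
      rw [Finset.card_range]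
    · exact rpow_sum_le _ _ hp
  -- The left side is constant in z and the pairs carry a probability measure, so averaging leaves a
  -- bound at x itself.
  have hint := lintegral_mono_ae hpt
  have hsR : Measurable fun z =>
      ∑ k ∈ Finset.range (r + 1), scaleVariation r F (x + (k : ℝ) • h) τ z ^ p :=
    Finset.measurable_fun_sum _ fun k _ => hRm k
  have hsW : Measurable fun z => ∑ q ∈ I, W q z ^ p :=
    Finset.measurable_fun_sum _ fun q _ => hWm q
  rw [lintegral_const, measure_univ, mul_one, lintegral_const_mul' _ _ (ENNReal.rpow_ne_top_of_nonneg hp.le (by simp)),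
    lintegral_add_left ((hsR.const_mul _).const_mul _), lintegral_const_mul _ (hsR.const_mul _),
    lintegral_const_mul _ hsR, lintegral_const_mul _ (hsW.const_mul _),
    lintegral_const_mul _ hsW, lintegral_finsetSum _ fun k _ => hRm k,
    lintegral_finsetSum _ fun q _ => hWm q] at hint
  have hR : ∑ k ∈ Finset.range (r + 1),
      ∫⁻ z, scaleVariation r F (x + (k : ℝ) • h) τ z ^ p ∂pairs d ≤
      (r + 1 : ℕ) * (K₁ * (N * ENNReal.ofReal (τ ^ (s * p - d)))) := by
    have := Finset.sum_le_card_nsmul (Finset.range (r + 1)) _ _ fun k hk =>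
      hK₁ F N hF hN _ (hyk k hk) τ hτ0 hτd hτr
    rwa [nsmul_eq_mul, Finset.card_range] at this
  have hWs : ∑ q ∈ I, ∫⁻ z, W q z ^ p ∂pairs d ≤
      I.card * (N * ENNReal.ofReal (τ ^ (-(d : ℝ)) * ‖h‖ ^ (s * p))) := by
    have := Finset.sum_le_card_nsmul I _ _ fun q hq =>
      lintegral_diff_contracted_le hF hN h0 h1 hx hτ0 hτr (Finset.mem_product.1 hq).1
        (Finset.mem_product.1 hq).2
    rwa [nsmul_eq_mul] at this
  refine hint.trans ?_
  rw [mul_assoc]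
  refine mul_le_mul_right ?_ _
  rw [add_mul]
  refine add_le_add ((mul_le_mul_right (mul_le_mul_right hR _) _).trans (le_of_eq ?_))
    ((mul_le_mul_right (mul_le_mul_right hWs _) _).trans (le_of_eq ?_))
  · rw [hB₁, hτ, Real.mul_rpow hκ0.le hh.le, ENNReal.ofReal_mul (by positivity)]
    ring
  · have h5 : τ ^ (-(d : ℝ)) * ‖h‖ ^ (s * p) = κ ^ (-(d : ℝ)) * ‖h‖ ^ (s * p - d) := by
      rw [hτ, Real.mul_rpow hκ0.le hh.le, sub_eq_add_neg, Real.rpow_add hh]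
      ring
    rw [h5, hB₂, ENNReal.ofReal_mul (by positivity)]
    ring

/-! ### Construction of the continuous representative. -/

theorem diff_zero_step {d : ℕ} {r : ℕ} (hr : 1 ≤ r) (F : E d → ℝ) (x : E d) :
    diff r 0 F x = 0 := by
  have h := sub_shiftMean r 0 F x
  have h2 : shiftMean r 0 F x = F x := by
    rw [← shiftMean_const hr (0 : E d) (F x) x]
    simp [shiftMean]
  rw [h2, sub_self] at h
  simpa using h.symm

/-- `|Δ_h^r F| ≤ M |h|^α` almost everywhere, for every fixed step `h` of norm at most one. -/
def LipDiffBound {d : ℕ} (r : ℕ) (α M : ℝ) (F : E d → ℝ) : Prop :=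
  ∀ h : E d, h ≠ 0 → ‖h‖ ≤ 1 → ∀ᵐ x, x ∈ shrink (openCube d) ((r : ℝ) • h) →
    ‖diff r h F x‖ ≤ M * ‖h‖ ^ α

theorem LipDiffBound.ae_sub_shiftMean_le {d : ℕ} {r : ℕ} (hr : 1 ≤ r) {α M : ℝ} (hα : 0 ≤ α)
    (hM : 0 ≤ M) {F : E d → ℝ} (hF : Measurable F) (H : LipDiffBound r α M F) :
    ∀ᵐ y, y ∈ openCube d → ∀ τ : ℝ, 0 < τ → r * τ ≤ 1 → τ * d ≤ 1 →
      ∀ᵐ z, z ∈ openCube d →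
        ‖F y - shiftMean r (τ • (z - y)) F y‖ ≤ M * (τ * d) ^ α := by
  have hmeas : MeasurableSet {q : E d × E d | (q.1 ≠ 0 ∧ ‖q.1‖ ≤ 1 ∧ q.2 ∈ openCube d ∧
      q.2 + (r : ℝ) • q.1 ∈ openCube d) → ‖diff r q.1 F q.2‖ ≤ M * ‖q.1‖ ^ α} := by
    refine MeasurableSet.imp (MeasurableSet.inter ?_ (MeasurableSet.inter ?_
      (MeasurableSet.inter ?_ ?_))) ?_
    · exact (measurableSet_singleton (0 : E d)).compl.preimage measurable_fst
    · exact measurableSet_le (f := fun q : E d × E d => ‖q.1‖) (by fun_prop) measurable_const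
    · exact (measurableSet_openCube d).preimage measurable_snd
    · exact (measurableSet_openCube d).preimage
        (f := fun q : E d × E d => q.2 + (r : ℝ) • q.1) (by fun_prop)
    · exact measurableSet_le (measurable_diff hF).norm (by fun_prop)
  have h1 : ∀ᵐ v : E d, ∀ᵐ y : E d, (v ≠ 0 ∧ ‖v‖ ≤ 1 ∧ y ∈ openCube d ∧
      y + (r : ℝ) • v ∈ openCube d) → ‖diff r v F y‖ ≤ M * ‖v‖ ^ α := by
    refine Filter.Eventually.of_forall fun v => ?_
    by_cases hv : v ≠ 0 ∧ ‖v‖ ≤ 1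
    · filter_upwards [H v hv.1 hv.2] with y hy hyv
      exact hy ((mem_shrink_iff (convex_openCube d)).2 hyv.2.2)
    · exact Filter.Eventually.of_forall fun y hyv => absurd ⟨hyv.1, hyv.2.1⟩ hv
  -- Exchanging the quantifiers puts the null set on y before the choice of τ; for each τ the
  -- exceptional steps are then pulled back by z ↦ τ(z - y).
  rw [Measure.ae_ae_comm hmeas] at h1
  filter_upwards [h1] with y hy hyΩ τ hτ hrτ hτd
  filter_upwards [(quasiMeasurePreserving_affine (-(τ • y)) hτ.ne').ae hy] with z hz hzΩ
  have h2 : -(τ • y) + τ • z = τ • (z - y) := by module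
  rw [h2] at hz
  rw [sub_shiftMean, norm_mul, norm_pow, norm_neg, norm_one, one_pow, one_mul]
  by_cases h0 : τ • (z - y) = 0
  · rw [h0, diff_zero_step hr, norm_zero]
    positivity
  have hn : ‖τ • (z - y)‖ ≤ τ * d := by
    rw [norm_smul, Real.norm_of_nonneg hτ.le]
    gcongr
    exact norm_sub_le_of_mem_closedCube (openCube_subset_closedCube d hzΩ)
      (openCube_subset_closedCube d hyΩ)
  refine (hz ⟨h0, hn.trans hτd, hyΩ, ?_⟩).trans (by gcongr)
  convert add_smul_sub_add_smul_sub_mem hyΩ hzΩ hzΩ (α := r * τ) (β := 0) (by positivity)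
    le_rfl (by linarith) using 1
  module

/-- A closed inequality that holds almost everywhere on an open set holds on its closure. -/
theorem le_of_ae_le_of_continuousOn {d : ℕ} {U : Set (E d)} (hU : IsOpen U) {φ : E d → ℝ}
    {V : Set (E d)} (hUV : U ⊆ V) (hVU : V ⊆ closure U)
    (hφ : ContinuousOn φ V) {c : ℝ} (h : ∀ᵐ y, y ∈ U → φ y ≤ c) : ∀ y ∈ V, φ y ≤ c := by
  intro y hy
  have h1 : Dense {y | y ∈ U → φ y ≤ c} := Measure.dense_of_ae h
  have h2 : y ∈ closure (U ∩ {y | y ∈ U → φ y ≤ c}) :=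
    closure_minimal (h1.open_subset_closure_inter hU) isClosed_closure (hVU hy)
  have : (nhdsWithin y (U ∩ {y | y ∈ U → φ y ≤ c})).NeBot := mem_closure_iff_nhdsWithin_neBot.1 h2
  have h3 : ∀ᶠ z in nhdsWithin y (U ∩ {y | y ∈ U → φ y ≤ c}), φ z ≤ c :=
    Filter.eventually_of_mem self_mem_nhdsWithin fun z hz => hz.2 hz.1
  exact le_of_tendsto ((hφ y hy).mono (inter_subset_left.trans hUV)) h3

/-- The functions G n are uniformly Cauchy off a null set, hence by continuity on the whole closed
cube, and their uniform limit is the representative. -/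
theorem exists_continuousOn_of_ae_le {d : ℕ} {F : E d → ℝ} {G : ℕ → E d → ℝ} {ε : ℕ → ℝ}
    (hG : ∀ n, Continuous (G n)) (hε : Filter.Tendsto ε Filter.atTop (nhds 0))
    (h : ∀ n, ∀ᵐ y, y ∈ openCube d → ‖F y - G n y‖ ≤ ε n) :
    ∃ g : E d → ℝ, ContinuousOn g (closedCube d) ∧ ∀ᵐ y, y ∈ openCube d → F y = g y := by
  have h1 : ∀ m n, ∀ y ∈ closedCube d, ‖G m y - G n y‖ ≤ ε m + ε n := by
    intro m n
    refine le_of_ae_le_of_continuousOn (isOpen_openCube d) (openCube_subset_closedCube d)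
      (closedCube_subset_closure d) (((hG m).sub (hG n)).norm.continuousOn) ?_
    filter_upwards [h m, h n] with y hm hn hy
    have h2 : G m y - G n y = -(F y - G m y) + (F y - G n y) := by ring
    rw [Pi.sub_apply, h2]
    refine (norm_add_le _ _).trans ?_
    rw [norm_neg]
    exact add_le_add (hm hy) (hn hy)
  have hcau : UniformCauchySeqOn G Filter.atTop (closedCube d) := by
    rw [Metric.uniformCauchySeqOn_iff]
    intro δ hδ
    obtain ⟨n₀, hn₀⟩ := Filter.eventually_atTop.1 (hε.eventually (gt_mem_nhds (half_pos hδ)))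
    refine ⟨n₀, fun m hm n hn y hy => ?_⟩
    rw [dist_eq_norm]
    linarith [h1 m n y hy, hn₀ m hm, hn₀ n hn]
  have hlim : ∀ y, ∃ l, y ∈ closedCube d → Filter.Tendsto (fun n => G n y) Filter.atTop (nhds l) := by
    intro y
    by_cases hy : y ∈ closedCube d
    · obtain ⟨l, hl⟩ := cauchySeq_tendsto_of_complete (hcau.cauchySeq hy)
      exact ⟨l, fun _ => hl⟩
    · exact ⟨0, fun h => absurd h hy⟩
  choose g hg using hlim
  refine ⟨g, (hcau.tendstoUniformlyOn_of_tendsto fun y hy => hg y hy).continuousOn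
    (Filter.Eventually.of_forall fun n => (hG n).continuousOn).frequently, ?_⟩
  filter_upwards [ae_all_iff.2 h] with y hy hyΩ
  refine tendsto_nhds_unique ?_ (hg y (openCube_subset_closedCube d hyΩ))
  rw [tendsto_iff_norm_sub_tendsto_zero]
  refine squeeze_zero (fun _ => norm_nonneg _) (fun n => ?_) hε
  rw [norm_sub_rev]
  exact hy n hyΩ

theorem integrable_comp_affine {d : ℕ} {F : E d → ℝ} (hF : Integrable F) (q : E d) {c : ℝ}
    (hc : c ≠ 0) : Integrable fun z => F (q + c • z) :=
  (hF.comp_add_left q).comp_smul hc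

/-- Averages of an integrable function over contracted cubes depend continuously on the point
towards which the cube is contracted. -/
theorem continuous_average_contracted {d : ℕ} {F : E d → ℝ} (hF : Integrable F) {c : ℝ}
    (hc : 0 < c) : Continuous fun y => ∫ z in openCube d, F (y + c • (z - y)) := by
  set χ : E d → ℝ := (openCube d).indicator fun _ => 1 with hχ
  have hχm : Measurable χ := measurable_const.indicator (measurableSet_openCube d)
  -- The change of variables moves the dependence on y from F, which may be discontinuous, to the
  -- indicator of the cube.
  have h1 : ∀ y, ∫ z in openCube d, F (y + c • (z - y)) =
      |(c ^ d)⁻¹| * ∫ u, χ (-(c⁻¹ • (1 - c) • y) + c⁻¹ • u) * F u := by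
    intro y
    have h2 := Measure.integral_comp_smul (volume : Measure (E d))
      (fun x => χ (c⁻¹ • x) * F ((1 - c) • y + x)) c
    rw [finrank_euclideanSpace_fin, smul_eq_mul] at h2
    rw [← integral_add_left_eq_self (fun u => χ (-(c⁻¹ • (1 - c) • y) + c⁻¹ • u) * F u)
      ((1 - c) • y), ← integral_indicator (measurableSet_openCube d)]
    have h3 : ∀ x, -(c⁻¹ • (1 - c) • y) + c⁻¹ • ((1 - c) • y + x) = c⁻¹ • x := fun x => by module
    simp only [h3]
    rw [← h2]
    refine integral_congr_ae (Filter.Eventually.of_forall fun z => ?_)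
    have h4 : y + c • (z - y) = (1 - c) • y + c • z := by module
    have h5 : c⁻¹ • c • z = z := by rw [smul_smul, inv_mul_cancel₀ hc.ne', one_smul]
    by_cases hz : z ∈ openCube d
    · simp [hχ, hz, h4, h5]
    · simp [hχ, hz, h5]
  simp only [h1]
  refine continuous_const.mul (continuous_iff_continuousAt.2 fun y₀ => ?_)
  refine continuousAt_of_dominated (bound := fun u => ‖F u‖) ?_ ?_ hF.norm ?_
  · exact Filter.Eventually.of_forall fun y =>
      ((hχm.comp (by fun_prop)).aestronglyMeasurable).mul hF.aestronglyMeasurable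
  · refine Filter.Eventually.of_forall fun y => Filter.Eventually.of_forall fun u => ?_
    rw [norm_mul]
    refine mul_le_of_le_one_left (norm_nonneg _) ?_
    simp only [hχ, indicator]
    split_ifs <;> simp
  -- The boundary of a convex set is null, so the indicator is continuous at almost every argument
  -- and dominated convergence applies.
  · have h6 : ∀ᵐ x : E d, x ∉ frontier (openCube d) :=
      measure_eq_zero_iff_ae_notMem.1 ((convex_openCube d).addHaar_frontier volume)
    filter_upwards [(quasiMeasurePreserving_affine (-(c⁻¹ • (1 - c) • y₀))
      (inv_ne_zero hc.ne')).ae h6] with u hu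
    refine ContinuousAt.mul ?_ continuousAt_const
    have h7 : ContinuousAt χ (-(c⁻¹ • (1 - c) • y₀) + c⁻¹ • u) :=
      continuousOn_const.continuousAt_indicator hu
    exact ContinuousAt.comp (f := fun y => -(c⁻¹ • (1 - c) • y) + c⁻¹ • u) h7
      (Continuous.continuousAt (by fun_prop))

/-- An integrable function whose differences satisfy a Lipschitz bound of positive order is almost
everywhere equal to a function that is continuous on the closed cube. -/
theorem LipDiffBound.exists_continuousOn {d : ℕ} {r : ℕ} (hr : 1 ≤ r) {α M : ℝ} (hα : 0 < α)
    (hM : 0 ≤ M) {F : E d → ℝ} (hF : Measurable F) (hFi : Integrable F)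
    (H : LipDiffBound r α M F) :
    ∃ g : E d → ℝ, ContinuousOn g (closedCube d) ∧ ∀ᵐ y, y ∈ openCube d → F y = g y := by
  set τ : ℕ → ℝ := fun n => 1 / (r + d) * (1 / (n + 1)) with hτ
  have hr1 : (1 : ℝ) ≤ r := by exact_mod_cast hr
  have hτ0 : ∀ n, 0 < τ n := fun n => by simp only [hτ]; positivity
  have hle : ∀ n, τ n ≤ 1 / (r + d) := fun n => by
    simp only [hτ]
    refine mul_le_of_le_one_right (by positivity) ?_
    rw [div_le_one (by positivity)]
    have : (0 : ℝ) ≤ n := by positivity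
    linarith
  have hτr : ∀ n, r * τ n ≤ 1 := fun n => by
    refine (mul_le_mul_of_nonneg_left (hle n) (by positivity)).trans ?_
    rw [mul_one_div, div_le_one (by positivity)]
    simp
  have hτd : ∀ n, τ n * d ≤ 1 := fun n => by
    refine (mul_le_mul_of_nonneg_right (hle n) (by positivity)).trans ?_
    rw [one_div_mul_eq_div, div_le_one (by positivity)]
    linarith
  have hint : ∀ (n : ℕ) (y : E d), ∀ j ∈ Finset.Icc 1 r,
      IntegrableOn (fun z => F (y + (j * τ n) • (z - y))) (openCube d) := by
    intro n y j hj
    have h0 : (j * τ n : ℝ) ≠ 0 := by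
      have h1 := (Finset.mem_Icc.1 hj).1
      have := hτ0 n
      positivity
    have h1 := (integrable_comp_affine hFi (y - (j * τ n) • y) h0).integrableOn (s := openCube d)
    have h2 : ∀ z, y + (j * τ n) • (z - y) = y - (j * τ n) • y + (j * τ n) • z :=
      fun z => by module
    simpa only [h2] using h1
  refine exists_continuousOn_of_ae_le (F := F) (G := fun n y => ∑ j ∈ Finset.Icc 1 r,
    (-1) ^ (j + 1) * (r.choose j : ℝ) * ∫ z in openCube d, F (y + (j * τ n) • (z - y)))
    (ε := fun n => M * (τ n * d) ^ α) ?_ ?_ ?_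
  · intro n
    refine continuous_finsetSum _ fun j hj => continuous_const.mul
      (continuous_average_contracted hFi ?_)
    have h1 := (Finset.mem_Icc.1 hj).1
    have := hτ0 n
    positivity
  · have h1 : Filter.Tendsto (fun n => τ n * d) Filter.atTop (nhds 0) := by
      have h2 := (tendsto_one_div_add_atTop_nhds_zero_nat (𝕜 := ℝ)).const_mul (1 / ((r : ℝ) + d))
      have h3 := h2.mul_const (d : ℝ)
      simpa only [mul_zero, zero_mul] using h3
    have h4 := (h1.rpow_const (Or.inr hα.le)).const_mul M
    rwa [Real.zero_rpow hα.ne', mul_zero] at h4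
  · intro n
    filter_upwards [H.ae_sub_shiftMean_le hr hα.le hM hF] with y hy hyΩ
    have h1 := hy hyΩ (τ n) (hτ0 n) (hτr n) (hτd n)
    have h2 : ∀ j ∈ Finset.Icc 1 r, IntegrableOn (fun z => (-1) ^ (j + 1) * (r.choose j : ℝ) *
        F (y + (j * τ n) • (z - y))) (openCube d) := fun j hj => (hint n y j hj).const_mul _
    -- Averaging the reproducing error over z bounds the distance to a continuous function by
    -- M(τd)^α.
    have h3 : F y - ∑ j ∈ Finset.Icc 1 r, (-1) ^ (j + 1) * (r.choose j : ℝ) *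
        ∫ z in openCube d, F (y + (j * τ n) • (z - y)) =
        ∫ z in openCube d, (F y - shiftMean r (τ n • (z - y)) F y) := by
      simp only [shiftMean, smul_smul]
      rw [integral_sub (integrable_const _) (integrable_finsetSum _ h2),
        integral_finsetSum _ h2, integral_const]
      simp [integral_const_mul]
    rw [h3]
    have h4 := norm_integral_le_of_norm_le_const (μ := volume.restrict (openCube d))
      ((ae_restrict_iff' (measurableSet_openCube d)).2 h1)
    simpa using h4

/-- F(y) is a bounded error plus values of F at random points. Averaging the p-th powers bounds it
by the L_p integral, which for p < 1 supplies the missing integrability. -/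
theorem LipDiffBound.exists_ae_norm_le {d : ℕ} {r : ℕ} (hr : 1 ≤ r) {α M : ℝ} (hα : 0 ≤ α)
    (hM : 0 ≤ M) {F : E d → ℝ} (hF : Measurable F) (H : LipDiffBound r α M F) {p : ℝ}
    (hp : 0 < p) (hFp : ∫⁻ y in openCube d, ‖F y‖ₑ ^ p ≠ ∞) :
    ∃ B : ℝ, ∀ᵐ y, y ∈ openCube d → ‖F y‖ ≤ B := by
  set τ : ℝ := 1 / (r + d) with hτ
  have hr1 : (1 : ℝ) ≤ r := by exact_mod_cast hr
  have hτ0 : 0 < τ := by positivity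
  have hτr : r * τ ≤ 1 := by
    rw [hτ, mul_one_div, div_le_one (by positivity)]
    simp
  have hτd : τ * d ≤ 1 := by
    rw [hτ, one_div_mul_eq_div, div_le_one (by positivity)]
    linarith
  set A : ℝ≥0∞ := ENNReal.ofReal (M * (τ * d) ^ α) with hA
  set J := ∫⁻ y in openCube d, ‖F y‖ₑ ^ p with hJ
  set S : ℝ≥0∞ := ∑ j ∈ Finset.Icc 1 r, ENNReal.ofReal ((j * τ) ^ (-(d : ℝ))) * J with hS
  set Q : ℝ≥0∞ := 2 ^ p * (A ^ p + (2 ^ r) ^ p *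
    (((Finset.Icc 1 r).card : ℝ≥0∞) ^ p * S)) with hQ
  have hfin : ∀ m : ℕ, (m : ℝ≥0∞) ^ p ≠ ∞ := fun m =>
    ENNReal.rpow_ne_top_of_nonneg hp.le (ENNReal.natCast_ne_top m)
  have hQt : Q ≠ ∞ := by
    have h2 := hfin 2
    have h3 := hfin (2 ^ r)
    push_cast at h2 h3
    refine ENNReal.mul_ne_top h2 (ENNReal.add_ne_top.2
      ⟨ENNReal.rpow_ne_top_of_nonneg hp.le ENNReal.ofReal_ne_top,
        ENNReal.mul_ne_top h3 (ENNReal.mul_ne_top (hfin _) ?_)⟩)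
    exact ENNReal.sum_ne_top.2 fun j _ => ENNReal.mul_ne_top ENNReal.ofReal_ne_top hFp
  refine ⟨(Q ^ (1 / p)).toReal, ?_⟩
  filter_upwards [H.ae_sub_shiftMean_le hr hα hM hF] with y hy hyΩ
  have h1 := (ae_restrict_iff' (measurableSet_openCube d)).2 (hy hyΩ τ hτ0 hτr hτd)
  have hm : ∀ j : ℕ, Measurable fun z => ‖F (y + (j : ℝ) • τ • (z - y))‖ₑ ^ p := fun j => by
    fun_prop
  have h2 : ∀ᵐ z ∂volume.restrict (openCube d), ‖F y‖ₑ ^ p ≤ 2 ^ p * (A ^ p + (2 ^ r) ^ p *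
      (((Finset.Icc 1 r).card : ℝ≥0∞) ^ p *
        ∑ j ∈ Finset.Icc 1 r, ‖F (y + (j : ℝ) • τ • (z - y))‖ₑ ^ p)) := by
    filter_upwards [h1] with z hz
    have h3 : ‖F y‖ₑ ≤ A + 2 ^ r * ∑ j ∈ Finset.Icc 1 r, ‖F (y + (j : ℝ) • τ • (z - y))‖ₑ := by
      calc ‖F y‖ₑ = ‖(F y - shiftMean r (τ • (z - y)) F y)
            + shiftMean r (τ • (z - y)) F y‖ₑ := by rw [sub_add_cancel]
        _ ≤ _ := (enorm_add_le _ _).trans (add_le_add ?_ (enorm_shiftMean_le _ _ _ _))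
      rw [← ofReal_norm]
      exact ENNReal.ofReal_le_ofReal hz
    refine (ENNReal.rpow_le_rpow h3 hp.le).trans ((rpow_add_le _ _ hp).trans ?_)
    rw [ENNReal.mul_rpow_of_nonneg _ _ hp.le]
    gcongr
    exact rpow_sum_le _ _ hp
  have h4 := lintegral_mono_ae h2
  have hsm : Measurable fun z =>
      ∑ j ∈ Finset.Icc 1 r, ‖F (y + (j : ℝ) • τ • (z - y))‖ₑ ^ p :=
    Finset.measurable_fun_sum _ fun j _ => hm j
  rw [lintegral_const, measure_univ, mul_one,
    lintegral_const_mul' _ _ (ENNReal.rpow_ne_top_of_nonneg hp.le (by simp)),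
    lintegral_add_left measurable_const, lintegral_const, measure_univ, mul_one,
    lintegral_const_mul _ (hsm.const_mul _), lintegral_const_mul _ hsm,
    lintegral_finsetSum _ fun j _ => hm j] at h4
  have h5 : ‖F y‖ₑ ^ p ≤ Q := by
    refine h4.trans ?_
    rw [hQ, hS]
    gcongr with j hj
    have hj1 : (1 : ℝ) ≤ j := by exact_mod_cast (Finset.mem_Icc.1 hj).1
    have hjr : (j : ℝ) ≤ r := by exact_mod_cast (Finset.mem_Icc.1 hj).2
    have h6 : ∀ z, y + (j : ℝ) • τ • (z - y) = (y - (j * τ) • y) + (j * τ) • z :=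
      fun z => by module
    simp only [h6]
    refine setLIntegral_comp_affine_le (y - (j * τ) • y) (by positivity)
      (measurableSet_openCube d) (measurableSet_openCube d) (fun z hz => ?_)
      (fun x => ‖F x‖ₑ ^ p)
    convert add_smul_sub_add_smul_sub_mem hyΩ hz hz (α := j * τ) (β := 0) (by positivity)
      le_rfl (by nlinarith) using 1
    module
  have h7 : ‖F y‖ₑ ≤ Q ^ (1 / p) := by rwa [one_div, ENNReal.le_rpow_inv_iff hp]
  rw [← toReal_enorm]
  exact ENNReal.toReal_mono (ENNReal.rpow_ne_top_of_nonneg (by positivity) hQt) h7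

/-! ### Transfer to the closed cube and to long steps. -/

/-- The almost everywhere bound for differences passes to the continuous representative. -/
theorem LipDiffBound.norm_diff_le {d : ℕ} {r : ℕ} {α M : ℝ} {F g : E d → ℝ}
    (H : LipDiffBound r α M F) (hα : 0 ≤ α) (hM : 0 ≤ M) (hg : ContinuousOn g (closedCube d))
    (hFg : ∀ᵐ y, y ∈ openCube d → F y = g y) {h x : E d} (h0 : h ≠ 0) (h1 : ‖h‖ ≤ 1)
    (hx : x ∈ shrink (closedCube d) ((r : ℝ) • h)) : ‖diff r h g x‖ ≤ M * ‖h‖ ^ α := by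
  have hopen : ∀ h : E d, h ≠ 0 → ‖h‖ ≤ 1 → ∀ x ∈ shrink (openCube d) ((r : ℝ) • h),
      ‖diff r h g x‖ ≤ M * ‖h‖ ^ α := by
    intro h h0 h1
    refine le_of_ae_le_of_continuousOn (isOpen_shrink_openCube _) subset_rfl subset_closure ?_ ?_
    · refine ContinuousOn.norm ?_
      rw [funext (diff_eq_sum_real r h g)]
      refine continuousOn_const.mul (continuousOn_finsetSum _ fun k hk =>
        continuousOn_const.mul ?_)
      exact hg.comp (by fun_prop) fun x hx => openCube_subset_closedCube d
        (add_smul_mem_of_mem_shrink hx (Nat.lt_succ_iff.1 (Finset.mem_range.1 hk)))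
    · have hk : ∀ᵐ x, ∀ k : ℕ, x + (k : ℝ) • h ∈ openCube d →
          F (x + (k : ℝ) • h) = g (x + (k : ℝ) • h) :=
        ae_all_iff.2 fun k =>
          (measurePreserving_add_right volume ((k : ℝ) • h)).quasiMeasurePreserving.ae hFg
      filter_upwards [H h h0 h1, hk] with x hx hxk hxs
      have h2 : diff r h g x = diff r h F x := by
        rw [diff_eq_sum_real, diff_eq_sum_real]
        refine congrArg _ (Finset.sum_congr rfl fun k hk => ?_)
        rw [hxk k (add_smul_mem_of_mem_shrink hxs (Nat.lt_succ_iff.1 (Finset.mem_range.1 hk)))]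
      rw [h2]
      exact hx hxs
  -- A progression in the closed cube is the limit of its contractions towards the center, which lie
  -- in the open cube and have shorter steps.
  set l := nhdsWithin (0 : ℝ) (Ioo 0 1) with hl
  have hlne : l.NeBot := by
    rw [hl, ← mem_closure_iff_nhdsWithin_neBot, closure_Ioo (by norm_num)]
    simp
  have hpt : ∀ (ε : ℝ) (k : ℝ), (1 - ε) • x + ε • center d + k • (1 - ε) • h =
      (1 - ε) • (x + k • h) + ε • center d := fun ε k => by module
  have hlim : Filter.Tendsto
      (fun ε : ℝ => ‖diff r ((1 - ε) • h) g ((1 - ε) • x + ε • center d)‖) l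
      (nhds ‖diff r h g x‖) := by
    refine Filter.Tendsto.norm ?_
    simp only [diff_eq_sum_real]
    refine Filter.Tendsto.const_mul _ (tendsto_finsetSum _ fun k hk =>
      Filter.Tendsto.const_mul _ ?_)
    have hxk := add_smul_mem_of_mem_shrink hx (Nat.lt_succ_iff.1 (Finset.mem_range.1 hk))
    refine (hg _ hxk).tendsto.comp (tendsto_nhdsWithin_iff.2 ⟨?_, ?_⟩)
    · have h2 : Continuous fun ε : ℝ => (1 - ε) • (x + (k : ℝ) • h) + ε • center d := by fun_prop
      have h3 := h2.tendsto 0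
      simp only [sub_zero, one_smul, zero_smul, add_zero] at h3
      simp only [hpt]
      exact h3.mono_left nhdsWithin_le_nhds
    · refine Filter.eventually_of_mem self_mem_nhdsWithin fun ε hε => ?_
      rw [hpt]
      exact openCube_subset_closedCube d (contract_mem hxk (center_mem d) hε.1 hε.2.le)
  refine le_of_tendsto hlim (Filter.eventually_of_mem self_mem_nhdsWithin fun ε hε => ?_)
  have h1ε : 0 < 1 - ε := by linarith [hε.2]
  have hnorm : ‖(1 - ε) • h‖ ≤ ‖h‖ := by
    rw [norm_smul, Real.norm_of_nonneg h1ε.le]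
    exact mul_le_of_le_one_left (norm_nonneg _) (by linarith [hε.1])
  refine (hopen _ (smul_ne_zero h1ε.ne' h0) (hnorm.trans h1) _ ?_).trans (by gcongr)
  rw [mem_shrink_iff (convex_openCube d)]
  refine ⟨contract_mem hx.1 (center_mem d) hε.1 hε.2.le, ?_⟩
  rw [hpt]
  exact contract_mem ((mem_shrink_iff (convex_closedCube d)).1 hx).2 (center_mem d) hε.1 hε.2.le

/-- A bound for differences with steps of norm at most one extends to steps of any size. -/
theorem norm_diff_le_of_norm_le_two_pow {d : ℕ} {r : ℕ} {α M : ℝ} (hα : 0 ≤ α) (hM : 0 ≤ M)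
    {S : Set (E d)} (hS : Convex ℝ S) {g : E d → ℝ}
    (H : ∀ h x : E d, h ≠ 0 → ‖h‖ ≤ 1 → x ∈ shrink S ((r : ℝ) • h) →
      ‖diff r h g x‖ ≤ M * ‖h‖ ^ α) (q : ℕ) :
    ∀ h x : E d, h ≠ 0 → ‖h‖ ≤ 2 ^ q → x ∈ shrink S ((r : ℝ) • h) →
      ‖diff r h g x‖ ≤ (2 ^ r) ^ q * M * ‖h‖ ^ α := by
  induction q with
  | zero => simpa using H
  | succ q ih =>
    intro h x h0 hq hx
    have hh : (2 : ℝ) • (2⁻¹ : ℝ) • h = h := by module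
    have hn : ‖(2⁻¹ : ℝ) • h‖ = 2⁻¹ * ‖h‖ := by rw [norm_smul]; norm_num
    have hterm : ∀ j ∈ Finset.range (r + 1),
        ‖(r.choose j : ℝ) * diff r ((2⁻¹ : ℝ) • h) g (x + (j : ℝ) • (2⁻¹ : ℝ) • h)‖ ≤
          (r.choose j : ℝ) * ((2 ^ r) ^ q * M * ‖h‖ ^ α) := by
      intro j hj
      have hjr := Nat.lt_succ_iff.1 (Finset.mem_range.1 hj)
      rw [norm_mul, Real.norm_of_nonneg (by positivity)]
      refine mul_le_mul_of_nonneg_left ?_ (by positivity)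
      refine (ih _ _ (smul_ne_zero (by norm_num) h0) ?_ ?_).trans ?_
      · rw [hn]
        rw [pow_succ] at hq
        linarith
      -- The endpoints of the halved progression are the midpoints of x + jh with x and with x + rh.
      · have hx' := (mem_shrink_iff hS).1 hx
        have hxj := add_smul_mem_of_mem_shrink hx hjr
        rw [mem_shrink_iff hS]
        constructor
        · convert hS hx'.1 hxj (a := 2⁻¹) (b := 2⁻¹) (by norm_num) (by norm_num) (by norm_num)
            using 1
          module
        · convert hS hx'.2 hxj (a := 2⁻¹) (b := 2⁻¹) (by norm_num) (by norm_num) (by norm_num)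
            using 1
          module
      · rw [hn]
        gcongr
        linarith [norm_nonneg h]
    have h2 := diff_two_smul r ((2⁻¹ : ℝ) • h) g x
    rw [hh] at h2
    rw [h2]
    refine (norm_sum_le_of_le _ hterm).trans (le_of_eq ?_)
    rw [← Finset.sum_mul]
    have h3 : ∑ j ∈ Finset.range (r + 1), (r.choose j : ℝ) = 2 ^ r := by
      exact_mod_cast Nat.sum_range_choose r
    rw [h3, pow_succ]
    ring

/-! ### From the Besov seminorm to the embedding. -/

theorem eLpNorm_diff_le_besovSeminorm {d : ℕ} (r : ℕ) (s : ℝ) (p : ℝ≥0∞) (f : E d → ℝ) {t : ℝ}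
    (ht : t ∈ Ioc (0 : ℝ) 1) {h : E d} (hh : ‖h‖ ≤ t) :
    eLpNorm (diff r h f) p (volume.restrict (shrink (openCube d) ((r : ℝ) • h))) ≤
      besovSeminorm r s p f * ENNReal.ofReal (t ^ s) := by
  have h1 : eLpNorm (diff r h f) p (volume.restrict (shrink (openCube d) ((r : ℝ) • h))) ≤
      modulus r p f t :=
    le_iSup₂ (f := fun (h : E d) (_ : ‖h‖ ≤ t) => eLpNorm (diff r h f) p
      (volume.restrict (shrink (openCube d) ((r : ℝ) • h)))) h hh
  have h2 : ENNReal.ofReal (t ^ (-s)) * modulus r p f t ≤ besovSeminorm r s p f :=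
    le_iSup₂ (f := fun (t : ℝ) (_ : t ∈ Ioc (0 : ℝ) 1) =>
      ENNReal.ofReal (t ^ (-s)) * modulus r p f t) t ht
  have ht0 := ht.1
  have h3 : ENNReal.ofReal (t ^ (-s)) * ENNReal.ofReal (t ^ s) = 1 := by
    rw [← ENNReal.ofReal_mul (by positivity), ← Real.rpow_add ht0]
    simp
  calc _ ≤ modulus r p f t := h1
    _ = ENNReal.ofReal (t ^ (-s)) * modulus r p f t * ENNReal.ofReal (t ^ s) := by
        rw [mul_right_comm, h3, one_mul]
    _ ≤ _ := by gcongr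

/-- Functions that agree almost everywhere on the cube have the same differences there. -/
theorem ae_diff_eq {d : ℕ} {r : ℕ} {f F : E d → ℝ} (hfF : ∀ᵐ y, y ∈ openCube d → f y = F y)
    (h : E d) : diff r h f =ᵐ[volume.restrict (shrink (openCube d) ((r : ℝ) • h))]
      diff r h F := by
  have hk : ∀ᵐ x, ∀ k : ℕ, x + (k : ℝ) • h ∈ openCube d →
      f (x + (k : ℝ) • h) = F (x + (k : ℝ) • h) :=
    ae_all_iff.2 fun k =>
      (measurePreserving_add_right volume ((k : ℝ) • h)).quasiMeasurePreserving.ae hfF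
  refine (ae_restrict_iff' (measurableSet_shrink_openCube _)).2 ?_
  filter_upwards [hk] with x hxk hxs
  rw [diff_eq_sum_real, diff_eq_sum_real]
  refine congrArg _ (Finset.sum_congr rfl fun k hk => ?_)
  rw [hxk k (add_smul_mem_of_mem_shrink hxs (Nat.lt_succ_iff.1 (Finset.mem_range.1 hk)))]

theorem diffBound_of_eLpNorm_le {d : ℕ} {r : ℕ} {s : ℝ} {p : ℝ≥0∞} (hp : 0 < p) (hpt : p ≠ ∞)
    {F : E d → ℝ} {N : ℝ≥0∞}
    (hN : ∀ t ∈ Ioc (0 : ℝ) 1, ∀ h : E d, ‖h‖ ≤ t →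
      eLpNorm (diff r h F) p (volume.restrict (shrink (openCube d) ((r : ℝ) • h))) ≤
        N * ENNReal.ofReal (t ^ s)) :
    DiffBound r p.toReal s (N ^ p.toReal) F := by
  intro t ht h hh
  have hp0 : 0 < p.toReal := ENNReal.toReal_pos hp.ne' hpt
  have ht0 := ht.1
  have h1 := hN t ht h hh
  rw [eLpNorm_eq_lintegral_rpow_enorm_toReal hp.ne' hpt, one_div,
    ENNReal.rpow_inv_le_iff hp0, ENNReal.mul_rpow_of_nonneg _ _ hp0.le,
    ENNReal.ofReal_rpow_of_pos (by positivity), ← Real.rpow_mul ht0.le] at h1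
  exact h1

/-- Functions of the Besov space satisfy a pointwise bound for differences, and have an integrable
version. -/
theorem exists_lipDiffBound {d : ℕ} (hd : 1 ≤ d) {p : ℝ≥0∞} (hp : 0 < p) {s : ℝ}
    (hs : ((d : ℝ≥0∞) / p).toReal < s) {r : ℕ} (hr : 1 ≤ r) :
    ∃ C : ℝ≥0, ∀ f : E d → ℝ, MemBesov r s p f → ∃ F : E d → ℝ,
      Measurable F ∧ Integrable F ∧ (∀ᵐ y, y ∈ openCube d → f y = F y) ∧
      LipDiffBound r (s - ((d : ℝ≥0∞) / p).toReal) (C * (besovSeminorm r s p f).toReal) F := by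
  have hversion : ∀ f : E d → ℝ, MemBesov r s p f → ∃ F : E d → ℝ, Measurable F ∧
      MemLp F p (volume.restrict (openCube d)) ∧ (∀ y, y ∉ openCube d → F y = 0) ∧
      (∀ᵐ y, y ∈ openCube d → f y = F y) := by
    intro f hf
    have hm := hf.1.1
    refine ⟨(openCube d).indicator (hm.mk f),
      hm.stronglyMeasurable_mk.measurable.indicator (measurableSet_openCube d), ?_,
      fun y hy => indicator_of_notMem hy _, ?_⟩
    · refine hf.1.ae_eq (hm.ae_eq_mk.trans ?_)
      exact (indicator_ae_eq_restrict (measurableSet_openCube d)).symm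
    · filter_upwards [(ae_restrict_iff' (measurableSet_openCube d)).1 hm.ae_eq_mk] with y hy hyΩ
      rw [indicator_of_mem hyΩ, hy hyΩ]
  -- The version vanishes off the cube, so integrability there is global, as the averaging argument
  -- requires.
  have hglobal : ∀ F : E d → ℝ, (∀ y, y ∉ openCube d → F y = 0) →
      Integrable F (volume.restrict (openCube d)) → Integrable F := fun F h0 hi =>
    (integrableOn_iff_integrable_of_support_subset fun y hy => by
      by_contra hyΩ
      exact hy (h0 y hyΩ)).1 hi
  have hdiff : ∀ f F : E d → ℝ, (∀ᵐ y, y ∈ openCube d → f y = F y) →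
      ∀ t ∈ Ioc (0 : ℝ) 1, ∀ h : E d, ‖h‖ ≤ t →
      eLpNorm (diff r h F) p (volume.restrict (shrink (openCube d) ((r : ℝ) • h))) ≤
        besovSeminorm r s p f * ENNReal.ofReal (t ^ s) := by
    intro f F hfF t ht h hh
    rw [← eLpNorm_congr_ae (ae_diff_eq hfF h)]
    exact eLpNorm_diff_le_besovSeminorm r s p f ht hh
  rcases eq_or_ne p ∞ with rfl | hpt
  · refine ⟨1, fun f hf => ?_⟩
    obtain ⟨F, hFm, hFp, hF0, hfF⟩ := hversion f hf
    refine ⟨F, hFm, hglobal F hF0 (hFp.integrable le_top), hfF, fun h h0 h1 => ?_⟩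
    have h2 := hdiff f F hfF ‖h‖ ⟨norm_pos_iff.2 h0, h1⟩ h le_rfl
    rw [eLpNorm_exponent_top] at h2
    filter_upwards [(ae_restrict_iff' (measurableSet_shrink_openCube _)).1
      (enorm_ae_le_eLpNormEssSup (diff r h F) _)] with x hx hxs
    have h3 := (hx hxs).trans h2
    have h4 := ENNReal.toReal_mono (ENNReal.mul_ne_top hf.2.ne ENNReal.ofReal_ne_top) h3
    rw [toReal_enorm, ENNReal.toReal_mul, ENNReal.toReal_ofReal (by positivity)] at h4
    simpa using h4
  · have hp0 : 0 < p.toReal := ENNReal.toReal_pos hp.ne' hpt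
    have hdp : ((d : ℝ≥0∞) / p).toReal = d / p.toReal := by
      rw [ENNReal.toReal_div, ENNReal.toReal_natCast]
    rw [hdp] at hs ⊢
    have hsp : (d : ℝ) < s * p.toReal := (div_lt_iff₀ hp0).1 hs
    obtain ⟨K, hK⟩ := ae_enorm_diff_rpow_le hd hr hp0 hsp
    refine ⟨K ^ (1 / p.toReal), fun f hf => ?_⟩
    obtain ⟨F, hFm, hFp, hF0, hfF⟩ := hversion f hf
    set N := besovSeminorm r s p f with hN
    have hNt : N ≠ ∞ := hf.2.ne
    have hL : LipDiffBound r (s - d / p.toReal) ((K ^ (1 / p.toReal) : ℝ≥0) * N.toReal) F := by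
      intro h h0 h1
      have hh : 0 < ‖h‖ := norm_pos_iff.2 h0
      filter_upwards [hK F (N ^ p.toReal) hFm (diffBound_of_eLpNorm_le hp hpt (hdiff f F hfF))
        h h0 h1] with x hx hxs
      have h2 := hx hxs
      rw [← ENNReal.le_rpow_inv_iff hp0, ENNReal.mul_rpow_of_nonneg _ _ (by positivity),
        ENNReal.mul_rpow_of_nonneg _ _ (by positivity), ENNReal.rpow_rpow_inv hp0.ne',
        ENNReal.ofReal_rpow_of_pos (by positivity), ← Real.rpow_mul hh.le] at h2
      have h4 := ENNReal.toReal_mono (ENNReal.mul_ne_top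
        (ENNReal.rpow_ne_top_of_nonneg (by positivity) ENNReal.coe_ne_top)
        (ENNReal.mul_ne_top hNt ENNReal.ofReal_ne_top)) h2
      rw [toReal_enorm, ENNReal.toReal_mul, ENNReal.toReal_mul,
        ENNReal.toReal_ofReal (by positivity), ← ENNReal.toReal_rpow, ENNReal.coe_toReal,
        ← mul_assoc] at h4
      rw [NNReal.coe_rpow, one_div]
      have h5 : (s * p.toReal - d) * p.toReal⁻¹ = s - d / p.toReal := by field_simp
      rwa [h5] at h4
    have hFf : ∫⁻ y in openCube d, ‖F y‖ₑ ^ p.toReal ≠ ∞ :=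
      (lintegral_rpow_enorm_lt_top_of_eLpNorm_lt_top hp.ne' hpt hFp.2).ne
    -- Boundedness replaces the inclusion of L_p in L_1, which fails for p < 1.
    obtain ⟨B, hB⟩ := hL.exists_ae_norm_le hr (by linarith) (by positivity) hFm hp0 hFf
    refine ⟨F, hFm, hglobal F hF0 ?_, hfF, hL⟩
    exact Integrable.of_bound hFm.aestronglyMeasurable B
      ((ae_restrict_iff' (measurableSet_openCube d)).2 hB)

end BesovCube

end

theorem theorem2p3 (d : ℕ) (hd : 1 ≤ d) (p : ℝ≥0∞) (hp : 0 < p) (s : ℝ)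
    (hs : ((d : ℝ≥0∞) / p).toReal < s) (r : ℕ) (hr : s < (r : ℝ)) :
    ∃ C : ℝ≥0, ∀ f : BesovCube.E d → ℝ, BesovCube.MemBesov r s p f →
      ∃ g : BesovCube.E d → ℝ,
        ContinuousOn g (BesovCube.closedCube d) ∧
        f =ᵐ[volume.restrict (BesovCube.openCube d)] g ∧
        (∀ t : ℝ, 0 < t →
          BesovCube.modulusC r g t ≤
            C * BesovCube.besovSeminorm r s p f *
              ENNReal.ofReal (t ^ (s - ((d : ℝ≥0∞) / p).toReal))) ∧
        BesovCube.MemLip r (s - ((d : ℝ≥0∞) / p).toReal) g := by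
  have hr1 : 1 ≤ r := by
    have h0 : (0 : ℝ) < r := ENNReal.toReal_nonneg.trans_lt (hs.trans hr)
    exact_mod_cast h0
  obtain ⟨C, hC⟩ := BesovCube.exists_lipDiffBound hd hp hs hr1
  have hα : 0 < s - ((d : ℝ≥0∞) / p).toReal := sub_pos.2 hs
  set α := s - ((d : ℝ≥0∞) / p).toReal
  -- A step whose progression fits in the cube satisfies r‖h‖ ≤ d ≤ 2^d, so d halvings suffice, each
  -- costing 2^r. This also covers all t > 1.
  refine ⟨(2 ^ r) ^ d * C, fun f hf => ?_⟩
  obtain ⟨F, hFm, hFi, hfF, hL⟩ := hC f hf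
  set N := BesovCube.besovSeminorm r s p f with hN
  have hNt : N ≠ ∞ := hf.2.ne
  have hM : 0 ≤ C * N.toReal := by positivity
  obtain ⟨g, hg, hFg⟩ := hL.exists_continuousOn hr1 hα hM hFm hFi
  have hmod : ∀ t : ℝ, 0 < t → BesovCube.modulusC r g t ≤
      ((2 ^ r) ^ d * C : ℝ≥0) * N * ENNReal.ofReal (t ^ α) := by
    intro t ht
    refine iSup₂_le fun h hh => iSup₂_le fun x hx => ?_
    rcases eq_or_ne h 0 with rfl | h0
    · rw [BesovCube.diff_zero_step hr1]
      simp
    have hbound : ‖h‖ ≤ 2 ^ d := by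
      have h1 := (BesovCube.mem_shrink_iff (BesovCube.convex_closedCube d)).1 hx
      have h2 := BesovCube.norm_sub_le_of_mem_closedCube h1.2 h1.1
      rw [add_sub_cancel_left, norm_smul, Real.norm_of_nonneg (by positivity)] at h2
      have h3 : (1 : ℝ) ≤ r := by exact_mod_cast hr1
      have h4 : (d : ℝ) ≤ 2 ^ d := by exact_mod_cast Nat.lt_two_pow_self.le
      nlinarith [norm_nonneg h]
    have h5 := BesovCube.norm_diff_le_of_norm_le_two_pow hα.le hM (BesovCube.convex_closedCube d)
      (fun h x h0 h1 hx => hL.norm_diff_le hα.le hM hg hFg h0 h1 hx) d h x h0 hbound hx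
    have h6 : ‖BesovCube.diff r h g x‖ ≤ ((2 ^ r) ^ d * C) * N.toReal * t ^ α := by
      refine h5.trans ?_
      rw [mul_assoc ((2 ^ r) ^ d : ℝ) C]
      gcongr
    rw [← ofReal_norm]
    refine (ENNReal.ofReal_le_ofReal h6).trans (le_of_eq ?_)
    rw [ENNReal.ofReal_mul (by positivity), ENNReal.ofReal_mul (by positivity),
      ENNReal.ofReal_toReal hNt]
    congr 2
    rw [ENNReal.ofReal, Real.toNNReal_of_nonneg (by positivity)]
    rfl
  refine ⟨g, hg, ?_, hmod, hg, (((2 ^ r) ^ d * C : ℝ≥0) * N).toNNReal, fun t ht => ?_⟩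
  · refine (ae_restrict_iff' (BesovCube.measurableSet_openCube d)).2 ?_
    filter_upwards [hfF, hFg] with y h1 h2 hy
    rw [h1 hy, h2 hy]
  · rw [ENNReal.coe_toNNReal (ENNReal.mul_ne_top ENNReal.coe_ne_top hNt)]
    exact hmod t ht
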